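/- Let $f,g:S^2\to\mathbb R^3$ be smooth embeddings that are transversal to each other and whose images meet in a single smoothly embedded circle. (The spheres may be given orientations; these play no role in the conclusion.) Then the two spheres cannot be separated along a good family: there is no good family $\Phi_t:S^2\to\mathbb R^3$, $t\in[0,1]$, relative to $g$, with $\Phi_0=f$ and $\Phi_1(S^2)\cap g(S^2)=\emptyset$. Here a *knot* is a smoothly embedded circle in $\mathbb R^3$, and a *link* is a union of finitely many (possibly zero) pairwise disjoint knots. A *good family relative to $g$* is a smooth map $\Phi:[0,1]\times S^2\to\mathbb R^3$, $\Phi_t=\Phi(t,\cdot)$, such that 1. every $\Phi_t$ is an embedding; 2. for every $t\in[0,1]$ the intersection $\Phi_t(S^2)\cap g(S^2)$ is a link; 3. the map $\Phi$ on the three-manifold $[0,1]\times S^2$ is transversal to $g$, that is, whenever $\Phi_t(p)=g(q)$, the vector $\partial_t\Phi(t,p)$ together with the images of $d_p\Phi_t$ and $d_q g$ spans $\mathbb R^3$; 4. there are only finitely many critical times, i.e. $t\in[0,1]$ for which $\Phi_t$ is not transversal to $g$; 5. at a critical time $t$, every point at which $\Phi_t$ and $g$ are not transversal lies on a knot $\gamma$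 along which the configuration is diffeomorphic to the following one: some diffeomorphism from an open neighbourhood of $\gamma$ in $\mathbb R^3$ onto an open neighbourhood of the circle $\{x^2+y^2=1,\ z=0\}$ carries $\gamma$ onto this circle, and the parts of $\Phi_t(S^2)$ and $g(S^2)$ in the first neighbourhood onto the parts in the second of, respectively, the surface $z=r(r-2)+1$, $r=\sqrt{x^2+y^2}$ (the parabola $z=x(x-2)+1$ rotated about the $z$-axis) and the plane $z=0$. -/

import Mathlib

open Set
open scoped Manifold ContDiff

namespace Bubbles

/-- Euclidean three-space. -/
abbrev E3 : Type := EuclideanSpace ℝ (Fin 3)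

/-- The standard two-sphere, with its standard smooth structure. -/
abbrev S2 : Type := Metric.sphere (0 : EuclideanSpace ℝ (Fin 3)) 1

/-- `f : S² → ℝ³` is a smooth (`C^∞`) embedding. -/
def IsSphereEmbedding (f : S2 → E3) : Prop :=
  Manifold.IsSmoothEmbedding (𝓡 2) (𝓡 3) ∞ f

/-- `c : S¹ → ℝ³` is a smooth (`C^∞`) embedding. -/
def IsCircleEmbedding (c : Circle → E3) : Prop :=
  Manifold.IsSmoothEmbedding (𝓡 1) (𝓡 3) ∞ c

/-- A knot: a smoothly embedded circle in `ℝ³`. -/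
def IsKnot (γ : Set E3) : Prop :=
  ∃ c : Circle → E3, IsCircleEmbedding c ∧ γ = range c

/-- A link: the union of finitely many pairwise disjoint knots. The empty link is allowed. -/
def IsLink (L : Set E3) : Prop :=
  ∃ (n : ℕ) (c : Fin n → Circle → E3),
    (∀ i, IsCircleEmbedding (c i)) ∧
    (∀ i j, i ≠ j → Disjoint (range (c i)) (range (c j))) ∧
    L = ⋃ i, range (c i)

/-- The image in `ℝ³` of the differential of `f` at `p`. -/
noncomputable def tangentImage (f : S2 → E3) (p : S2) : Submodule ℝ E3 :=
  (mvfderiv (𝓡 2) f p).range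

/-- `f` and `g` are transversal: wherever their images meet, their tangent planes span `ℝ³`. -/
def Transversal (f g : S2 → E3) : Prop :=
  ∀ p q : S2, f p = g q → tangentImage f p ⊔ tangentImage g q = ⊤

/-- The time derivative at `(t, p)` of a family defined for times in `[0,1]` (one-sided at the
end points). -/
noncomputable def velocity (Φ : ℝ → S2 → E3) (t : ℝ) (p : S2) : E3 :=
  derivWithin (fun s => Φ s p) (Icc 0 1) t

/-- The family `Φ`, as a map `[0,1] × S² → ℝ³` of a three-manifold, is transversal to `g`. The image
of its differential at `(t, p)` is spanned by the velocity and by the image of the differential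
of `Φ t`. -/
def FamilyTransversal (Φ : ℝ → S2 → E3) (g : S2 → E3) : Prop :=
  ∀ t ∈ Icc (0 : ℝ) 1, ∀ p q : S2, Φ t p = g q →
    Submodule.span ℝ {velocity Φ t p} ⊔ tangentImage (Φ t) p ⊔ tangentImage g q = ⊤

/-- The distance to the `z`-axis. -/
noncomputable def axisDist (x : E3) : ℝ := √(x 0 ^ 2 + x 1 ^ 2)

/-- The parabola `z = x (x - 2) + 1`, rotated about the `z`-axis. -/
def modelParabola : Set E3 := {x | x 2 = axisDist x * (axisDist x - 2) + 1}

/-- The `xy`-plane. -/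
def modelPlane : Set E3 := {x | x 2 = 0}

/-- The unit circle in the `xy`-plane. -/
def modelCircle : Set E3 := {x | x 0 ^ 2 + x 1 ^ 2 = 1 ∧ x 2 = 0}

/-- Along `γ` the pair of surfaces `A`, `B` is diffeomorphic to the rotated parabola and the plane
along the unit circle: a diffeomorphism from an open neighbourhood of `γ` onto an open
neighbourhood of the unit circle carries the parts of `A`, `B`, `γ` in the first
neighbourhood onto the parts of the three model sets in the second. -/
def HasModelTangency (A B γ : Set E3) : Prop :=
  ∃ Ψ : OpenPartialHomeomorph E3 E3,
    ContDiffOn ℝ ∞ Ψ Ψ.source ∧ ContDiffOn ℝ ∞ Ψ.symm Ψ.target ∧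
    γ ⊆ Ψ.source ∧ modelCircle ⊆ Ψ.target ∧
    Ψ '' γ = modelCircle ∧
    Ψ '' (A ∩ Ψ.source) = modelParabola ∩ Ψ.target ∧
    Ψ '' (B ∩ Ψ.source) = modelPlane ∩ Ψ.target

/-- A good family of embeddings `Φ t : S² → ℝ³`, `t ∈ [0,1]`, relative to the fixed embedding `g`.
Only the values of `Φ` at times in `[0,1]` matter. -/
structure IsGoodFamily (g : S2 → E3) (Φ : ℝ → S2 → E3) : Prop where
  /-- The family is smooth on `[0,1] × S²`. -/
  smooth : ContMDiffOn (𝓘(ℝ, ℝ).prod (𝓡 2)) (𝓡 3) ∞ (fun x : ℝ × S2 => Φ x.1 x.2)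
    (Icc (0 : ℝ) 1 ×ˢ univ)
  embedding : ∀ t ∈ Icc (0 : ℝ) 1, IsSphereEmbedding (Φ t)
  link : ∀ t ∈ Icc (0 : ℝ) 1, IsLink (range (Φ t) ∩ range g)
  transversal : FamilyTransversal Φ g
  /-- There are finitely many critical times. -/
  finite_critical : {t ∈ Icc (0 : ℝ) 1 | ¬ Transversal (Φ t) g}.Finite
  /-- Every point of non-transversality lies on a knot of model tangency. -/
  model : ∀ t ∈ Icc (0 : ℝ) 1, ∀ p q : S2, Φ t p = g q →
    tangentImage (Φ t) p ⊔ tangentImage g q ≠ ⊤ →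
    ∃ γ : Set E3, IsKnot γ ∧ Φ t p ∈ γ ∧ HasModelTangency (range (Φ t)) (range g) γ

end Bubbles

/-! The invariant is the number, modulo two, of components of the intersection along which the
spheres cross transversally. It is odd for a single transversal circle and zero for disjoint
spheres, so it suffices that it is locally constant in time.

Fix a time and isolate each component `C` of the intersection in its own open set. If `C` is
transversal throughout, implicit function arguments show that the nearby intersection is again
connected. Otherwise `C` is a circle of tangency. In the model, the height of the moving sphere over
the fixed one is `ρ ^ 2`, where `ρ` is the signed distance from the circle. Transversality of the
whole family forces the height to have nonzero time derivative along `C`. Hence, on either side of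
the critical time, the sphere lifts off and the intersection disappears, or it is pushed through and
the circle splits into two, one with `ρ > 0` and one with `ρ < 0`. Since `C` is connected, the same
alternative holds all along it. Both contribute an even number, and at the critical time `C` itself
has no transversal point and contributes nothing.

Only connectedness of the pieces is used, never that they are circles: `HasParity` counts relatively
open connected pieces. Locally the sheets of the intersection are graphs
(`exists_open_isConnected_zeros`, `exists_open_isConnected_sides`); `exists_open_isConnected` glues
them along `C`. The sign of the motion is `height_sign`, and the pieces are assembled in
`IsRegularFamily.eventually_hasParity`. The substitution `t = sin² s` replaces `[0,1]` by the whole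
line, so that end points need no separate treatment. -/

namespace Bubbles

open Filter Topology

/-! ### Counting connected pieces modulo two, and gluing local pieces along a connected set. -/

section Pieces

variable {X : Type*} [TopologicalSpace X]

/-- The set `K` is a disjoint union of finitely many relatively open connected pieces, whose number
has residue `a` modulo two. -/
def HasParity (K : Set X) (a : ZMod 2) : Prop :=
  ∃ (ι : Type) (_ : Fintype ι) (O : ι → Set X), (Fintype.card ι : ZMod 2) = a ∧
    (∀ i, IsOpen (O i)) ∧ K ⊆ ⋃ i, O i ∧
    (∀ i j, i ≠ j → Disjoint (K ∩ O i) (K ∩ O j)) ∧ ∀ i, IsConnected (K ∩ O i)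

/-- A preconnected subset of a set decomposed into relatively open pieces lies in one piece. -/
lemma subset_piece {ι : Type*} {K A : Set X} {O : ι → Set X} (hO : ∀ i, IsOpen (O i))
    (hK : K ⊆ ⋃ i, O i) (hd : ∀ i j, i ≠ j → Disjoint (K ∩ O i) (K ∩ O j))
    (hA : IsPreconnected A) (hAK : A ⊆ K) {x : X} (hx : x ∈ A) {i : ι} (hxi : x ∈ O i) :
    A ⊆ O i := by
  have h := isPreconnected_iff_subset_of_disjoint.1 hA (O i) (⋃ j ∈ {j | j ≠ i}, O j) (hO i)
    (isOpen_biUnion fun j _ => hO j) ?_ ?_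
  · rcases h with h | h
    · exact h
    · obtain ⟨j, hj, hxj⟩ := mem_iUnion₂.1 (h hx)
      exact absurd ⟨⟨hAK hx, hxj⟩, ⟨hAK hx, hxi⟩⟩ (fun h => (hd j i hj).le_bot h)
  · intro y hy
    obtain ⟨j, hj⟩ := mem_iUnion.1 (hK (hAK hy))
    by_cases hji : j = i
    · exact Or.inl (hji ▸ hj)
    · exact Or.inr (mem_iUnion₂.2 ⟨j, hji, hj⟩)
  · rw [eq_empty_iff_forall_notMem]
    rintro y ⟨hyA, hyi, hy⟩
    obtain ⟨j, hj, hyj⟩ := mem_iUnion₂.1 hy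
    exact (hd j i hj).le_bot ⟨⟨hAK hyA, hyj⟩, ⟨hAK hyA, hyi⟩⟩

/-- Each connected piece of the first decomposition falls into one piece of the second. The
resulting map of indices is injective because the target piece, being connected, in turn meets only
one piece of the first. Used in both directions, this makes the parity well defined. -/
lemma card_pieces_le {ι κ : Type*} [Fintype ι] [Fintype κ] {K : Set X} {O : ι → Set X}
    {P : κ → Set X}
    (hd : ∀ i j, i ≠ j → Disjoint (K ∩ O i) (K ∩ O j)) (hc : ∀ i, IsConnected (K ∩ O i))
    (hO : ∀ i, IsOpen (O i)) (hK : K ⊆ ⋃ i, O i)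
    (hP : ∀ i, IsOpen (P i)) (hK' : K ⊆ ⋃ i, P i)
    (hd' : ∀ i j, i ≠ j → Disjoint (K ∩ P i) (K ∩ P j)) (hc' : ∀ i, IsConnected (K ∩ P i)) :
    Fintype.card ι ≤ Fintype.card κ := by
  have h : ∀ i, ∃ j, K ∩ O i ⊆ P j := fun i => by
    obtain ⟨x, hx⟩ := (hc i).nonempty
    obtain ⟨j, hj⟩ := mem_iUnion.1 (hK' hx.1)
    exact ⟨j, subset_piece hP hK' hd' (hc i).isPreconnected inter_subset_left hx hj⟩
  choose φ hφ using h
  refine Fintype.card_le_of_injective φ fun i i' hii => ?_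
  by_contra hne
  obtain ⟨x, hx⟩ := (hc i).nonempty
  obtain ⟨y, hy⟩ := (hc i').nonempty
  have h1 : K ∩ P (φ i) ⊆ O i := subset_piece hO hK hd (hc' _).isPreconnected inter_subset_left
    ⟨hx.1, hφ i hx⟩ hx.2
  exact (hd i i' hne).le_bot ⟨⟨hy.1, h1 ⟨hy.1, hii ▸ hφ i' hy⟩⟩, hy⟩

lemma HasParity.unique {K : Set X} {a b : ZMod 2} (ha : HasParity K a) (hb : HasParity K b) :
    a = b := by
  obtain ⟨ι, _, O, rfl, hO, hK, hd, hc⟩ := ha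
  obtain ⟨κ, _, P, rfl, hP, hK', hd', hc'⟩ := hb
  rw [le_antisymm (card_pieces_le hd hc hO hK hP hK' hd' hc')
    (card_pieces_le hd' hc' hP hK' hO hK hd hc)]

lemma hasParity_empty : HasParity (∅ : Set X) 0 :=
  ⟨Empty, inferInstance, Empty.elim, by simp, by simp, by simp, by simp, by simp⟩

lemma hasParity_one_of_isConnected {K : Set X} (hK : IsConnected K) : HasParity K 1 :=
  ⟨Unit, inferInstance, fun _ => univ, by simp, by simp,
    fun x _ => mem_iUnion.2 ⟨(), mem_univ x⟩, by simp, by simpa using hK⟩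

/-- Additivity: the counts made near the separate components of the intersection at one time add up
to the total count. -/
lemma HasParity.iUnion {ι : Type} [Fintype ι] {K : Set X} {U : ι → Set X} {a : ι → ZMod 2}
    (hU : ∀ i, IsOpen (U i)) (hK : K ⊆ ⋃ i, U i) (hd : ∀ i j, i ≠ j → Disjoint (U i) (U j))
    (h : ∀ i, HasParity (K ∩ U i) (a i)) : HasParity K (∑ i, a i) := by
  choose κ hκ O hcard hO hcov hdis hconn using h
  have hset : ∀ i j, K ∩ (U i ∩ O i j) = K ∩ U i ∩ O i j := fun i j => (inter_assoc _ _ _).symm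
  refine ⟨Σ i, κ i, inferInstance, fun x => U x.1 ∩ O x.1 x.2, by simp [← hcard],
    fun x => (hU _).inter (hO _ _), fun x hx => ?_, ?_, fun x => ?_⟩
  · obtain ⟨i, hi⟩ := mem_iUnion.1 (hK hx)
    obtain ⟨j, hj⟩ := mem_iUnion.1 (hcov i ⟨hx, hi⟩)
    exact mem_iUnion.2 ⟨⟨i, j⟩, hi, hj⟩
  · rintro ⟨i, j⟩ ⟨i', j'⟩ hne
    by_cases hii : i = i'
    · subst hii
      simpa only [hset] using hdis i j j' (by rintro rfl; exact hne rfl)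
    · exact (hd i i' hii).mono (fun x hx => hx.2.1) (fun x hx => hx.2.1)
  · simpa only [hset] using hconn x.1 x.2

/-- A set split by two disjoint open sets into two connected parts has even parity. -/
lemma hasParity_zero_of_two {K P Q : Set X} (hP : IsOpen P) (hQ : IsOpen Q) (hPQ : Disjoint P Q)
    (hK : K ⊆ P ∪ Q) (h₁ : IsConnected (K ∩ P)) (h₂ : IsConnected (K ∩ Q)) : HasParity K 0 := by
  have := HasParity.iUnion (K := K) (U := fun b : Bool => cond b P Q) (a := fun _ => 1)
    (by simp [hP, hQ]) (by simpa [union_eq_iUnion] using hK)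
    (by simpa using ⟨hPQ.symm, hPQ⟩)
    (by simpa using ⟨hasParity_one_of_isConnected h₂, hasParity_one_of_isConnected h₁⟩)
  simpa [show (2 : ZMod 2) = 0 from rfl] using this

/-- If near every point of a compact connected set `C` the sets `K j s` are eventually connected,
then they are eventually connected in some neighbourhood of `C`. -/
lemma exists_open_isConnected {J S : Type*} [Finite J] {C W : Set X} (hC : IsCompact C)
    (hC' : IsConnected C) {l : Filter S} {K : J → S → Set X} {B : S → Set X}
    (h : ∀ p ∈ C, ∀ W ∈ 𝓝 p, ∃ V, IsOpen V ∧ p ∈ V ∧ V ⊆ W ∧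
      ∀ᶠ s in l, (∀ j, IsConnected (K j s ∩ V)) ∧ Disjoint (B s) V)
    (hW : IsOpen W) (hCW : C ⊆ W) :
    ∃ U, IsOpen U ∧ C ⊆ U ∧ U ⊆ W ∧
      ∀ᶠ s in l, (∀ j, IsConnected (K j s ∩ U)) ∧ Disjoint (B s) U := by
  choose! V hVo hpV hVW hV using fun p hp => h p hp W (hW.mem_nhds (hCW hp))
  obtain ⟨t, hCt⟩ := hC.elim_nhds_subcover' (fun p _ => V p)
    (fun p hp => (hVo p hp).mem_nhds (hpV p hp))
  -- Gluing needs common points of neighbouring pieces. They come from the hypothesis at a point of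
  -- `C` in the overlap, with the overlap itself as prescribed neighbourhood.
  have hmeet : ∀ p q : C, (V p ∩ V q ∩ C).Nonempty →
      ∀ᶠ s in l, ∀ j, (K j s ∩ (V p ∩ V q)).Nonempty := by
    rintro p q ⟨x, hx, hxC⟩
    obtain ⟨V', -, -, hV'W, hV'⟩ := h x hxC (V p ∩ V q)
      (((hVo p p.2).inter (hVo q q.2)).mem_nhds hx)
    filter_upwards [hV'] with s hs j
    exact (hs.1 j).nonempty.mono (inter_subset_inter_right _ hV'W)
  -- As `C` is connected, any two members of the finite cover are joined by a chain whose
  -- consecutive members overlap on `C`.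
  have hchain : ∀ p q : t, Relation.TransGen
      (fun a b : t => (((↑) : C → X) ⁻¹' V a.1 ∩ ((↑) : C → X) ⁻¹' V b.1).Nonempty) p q := by
    intro p q
    have hun : (⋃ a : t, ((↑) : C → X) ⁻¹' V a.1) = univ := by
      refine eq_univ_of_forall fun x => ?_
      obtain ⟨a, ha, hxa⟩ := mem_iUnion₂.1 (hCt x.2)
      exact mem_iUnion.2 ⟨⟨a, ha⟩, hxa⟩
    refine IsPreconnected.transGen_of_iUnion (s := fun a : t => ((↑) : C → X) ⁻¹' V a.1) ?_ ?_ p q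
      ⟨p.1, hpV _ p.1.2⟩ ⟨q.1, hpV _ q.1.2⟩
    · rw [hun]
      exact (isPreconnected_iff_preconnectedSpace.1 hC'.isPreconnected).isPreconnected_univ
    · exact fun a => (hVo _ a.1.2).preimage continuous_subtype_val
  refine ⟨⋃ p : t, V p.1, isOpen_iUnion fun p => hVo _ p.1.2, fun x hx => ?_,
    iUnion_subset fun p => hVW _ p.1.2, ?_⟩
  · obtain ⟨a, ha, hxa⟩ := mem_iUnion₂.1 (hCt hx)
    exact mem_iUnion.2 ⟨⟨a, ha⟩, hxa⟩
  have hev : ∀ᶠ s in l, ∀ p q : t, (V p.1 ∩ V q.1 ∩ C).Nonempty →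
      ∀ j, (K j s ∩ (V p.1 ∩ V q.1)).Nonempty := by
    refine eventually_all.2 fun p => eventually_all.2 fun q => ?_
    by_cases hpq : (V p.1 ∩ V q.1 ∩ C).Nonempty
    · filter_upwards [hmeet p.1 q.1 hpq] with s hs _ using hs
    · exact Eventually.of_forall fun s h => absurd h hpq
  filter_upwards [hev, eventually_all.2 fun p : t => hV p.1 p.1.2] with s hs hs'
  have : Nonempty t := by
    obtain ⟨x, hx⟩ := hC'.nonempty
    obtain ⟨a, ha, -⟩ := mem_iUnion₂.1 (hCt hx)
    exact ⟨⟨a, ha⟩⟩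
  refine ⟨fun j => ?_, disjoint_iUnion_right.2 fun p => (hs' p).2⟩
  rw [inter_iUnion]
  refine IsConnected.iUnion_of_reflTransGen (fun p => (hs' p).1 j) fun p q => ?_
  refine Relation.ReflTransGen.mono (fun a b => ?_) _ _ (hchain p q).to_reflTransGen
  rintro ⟨x, hxa, hxb⟩
  rw [← inter_inter_distrib_left]
  exact hs a b ⟨x, ⟨hxa, hxb⟩, x.2⟩ j

end Pieces

/-! ### Zero sets of functions on a normed space depending on a parameter. -/

section Flat

lemma exists_pos_eventually_forall_ball {S E : Type*} [PseudoMetricSpace E] {l : Filter S} {v₀ : E} {p : S × E → Prop}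
    (h : ∀ᶠ z in l ×ˢ 𝓝 v₀, p z) :
    ∃ δ > 0, ∀ᶠ s in l, ∀ v ∈ Metric.ball v₀ δ, p (s, v) := by
  obtain ⟨pa, ha, pb, hb, hp⟩ := eventually_prod_iff.1 h
  obtain ⟨δ, hδ, hball⟩ := Metric.eventually_nhds_iff_ball.1 hb
  exact ⟨δ, hδ, ha.mono fun s hs v hv => hp hs (hball v hv)⟩

variable {E : Type*} [NormedAddCommGroup E] [NormedSpace ℝ E]

/-- If every line parallel to `α` leaves the open set `N` and enters the disjoint open set `P`
through exactly one point, then these points form a connected set. -/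
lemma isConnected_graph {Y P N : Set E} (hY : IsConnected Y) (hP : IsOpen P) (hN : IsOpen N)
    (hPN : Disjoint N P) {α v₀ : E} {ε : ℝ}
    (h : ∀ y ∈ Y, ∃ r ∈ Ioo (-ε) ε, v₀ + r • α + y ∉ N ∧ v₀ + r • α + y ∉ P ∧
      (∀ x ∈ Ioo (-ε) r, v₀ + x • α + y ∈ N) ∧ ∀ x ∈ Ioo r ε, v₀ + x • α + y ∈ P) :
    IsConnected ({v | ∃ x ∈ Ioo (-ε) ε, ∃ y ∈ Y, v = v₀ + x • α + y} ∩ {v | v ∉ N ∧ v ∉ P}) := by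
  choose! r hr hrN hrP hlt hgt using h
  -- Just below `r y₁` the line lies in `N`, just above in `P`. Both conditions are open, so nearby
  -- lines cross between the same two parameters.
  have hcont : ContinuousOn r Y := by
    intro y₁ hy₁
    refine tendsto_order.2 ⟨fun a ha => ?_, fun a ha => ?_⟩
    · obtain ⟨x, hx, hxr⟩ := exists_between (max_lt ha (hr y₁ hy₁).1)
      have hmem : ∀ᶠ y in 𝓝 y₁, v₀ + x • α + y ∈ N :=
        ContinuousAt.preimage_mem_nhds (f := fun y => v₀ + x • α + y) (by fun_prop)
          (hN.mem_nhds (hlt y₁ hy₁ x ⟨(le_max_right _ _).trans_lt hx, hxr⟩))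
      filter_upwards [nhdsWithin_le_nhds hmem, self_mem_nhdsWithin] with y hy hyY
      by_contra! hle
      exact hPN.le_bot ⟨hy, hgt y hyY x
        ⟨hle.trans_lt ((le_max_left _ _).trans_lt hx), hxr.trans (hr y₁ hy₁).2⟩⟩
    · obtain ⟨x, hxr, hx⟩ := exists_between (lt_min ha (hr y₁ hy₁).2)
      have hmem : ∀ᶠ y in 𝓝 y₁, v₀ + x • α + y ∈ P :=
        ContinuousAt.preimage_mem_nhds (f := fun y => v₀ + x • α + y) (by fun_prop)
          (hP.mem_nhds (hgt y₁ hy₁ x ⟨hxr, hx.trans_le (min_le_right _ _)⟩))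
      filter_upwards [nhdsWithin_le_nhds hmem, self_mem_nhdsWithin] with y hy hyY
      by_contra! hle
      exact hPN.le_bot ⟨hlt y hyY x
        ⟨(hr y₁ hy₁).1.trans hxr, (hx.trans_le (min_le_left _ _)).trans_le hle⟩, hy⟩
  have himg : {v | ∃ x ∈ Ioo (-ε) ε, ∃ y ∈ Y, v = v₀ + x • α + y} ∩ {v | v ∉ N ∧ v ∉ P} =
      (fun y => v₀ + r y • α + y) '' Y := by
    ext v
    constructor
    · rintro ⟨⟨x, hx, y, hy, rfl⟩, hvN, hvP⟩
      have : r y = x := by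
        rcases lt_trichotomy x (r y) with h | h | h
        · exact absurd (hlt y hy x ⟨hx.1, h⟩) hvN
        · exact h.symm
        · exact absurd (hgt y hy x ⟨h, hx.2⟩) hvP
      exact ⟨y, hy, by simp [this]⟩
    · rintro ⟨y, hy, rfl⟩
      exact ⟨⟨r y, hr y hy, y, hy, rfl⟩, hrN y hy, hrP y hy⟩
  rw [himg]
  exact hY.image _ (by fun_prop)

/-- Small open boxes with one side parallel to `α`. -/
lemma exists_open_box {α : E} (hα : α ≠ 0) (v₀ : E) {ε δ : ℝ} (hε : 0 < ε) (hδ : 0 < δ) :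
    ∃ V Y : Set E, IsOpen V ∧ v₀ ∈ V ∧ IsConnected Y ∧ Y ⊆ Metric.ball 0 δ ∧
      V = {v | ∃ x ∈ Ioo (-ε) ε, ∃ y ∈ Y, v = v₀ + x • α + y} := by
  -- The functional splits the space into the line of `α` and the kernel of `ℓ`; the base `Y` is a
  -- ball in the kernel, convex and hence connected.
  obtain ⟨ℓ, hℓ⟩ := SeparatingDual.exists_eq_one (R := ℝ) hα
  refine ⟨{v | ℓ (v - v₀) ∈ Ioo (-ε) ε ∧ v - v₀ - ℓ (v - v₀) • α ∈ Metric.ball 0 δ},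
    {y | ℓ y = 0} ∩ Metric.ball 0 δ, ?_, ?_, ⟨⟨0, by simp [hδ]⟩, ?_⟩, inter_subset_right, ?_⟩
  · exact (isOpen_Ioo.preimage (f := fun v => ℓ (v - v₀)) (by fun_prop)).inter
      (Metric.isOpen_ball.preimage (f := fun v => v - v₀ - ℓ (v - v₀) • α) (by fun_prop))
  · simp [hε, hδ]
  · refine (Convex.inter ?_ (convex_ball _ _)).isPreconnected
    exact convex_hyperplane ℓ.toLinearMap.isLinear 0
  · ext v
    constructor
    · rintro ⟨h1, h2⟩
      exact ⟨_, h1, _, ⟨by simp [hℓ], h2⟩, by abel⟩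
    · rintro ⟨x, hx, y, ⟨hy, hyδ⟩, rfl⟩
      have hy' : ℓ y = 0 := hy
      have : ℓ (v₀ + x • α + y - v₀) = x := by
        rw [show v₀ + x • α + y - v₀ = x • α + y by abel]
        simp [hℓ, hy']
      rw [mem_ofPred_eq, this, show v₀ + x • α + y - v₀ - x • α = y by abel]
      exact ⟨hx, hyδ⟩

lemma exists_side_length (α : E) {η : ℝ} (hη : 0 < η) : ∃ ε : ℝ, 0 < ε ∧ ∀ v₀ : E, ∀ x ∈ Icc (-ε) ε,
    ∀ y ∈ Metric.ball (0 : E) (η / 2), v₀ + x • α + y ∈ Metric.ball v₀ η := by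
  -- Each of the two displacements may use half of the radius; the `+ 1` keeps the denominator
  -- positive.
  refine ⟨η / (2 * (‖α‖ + 1)), by positivity, fun v₀ x hx y hy => ?_⟩
  rw [mem_ball_zero_iff] at hy
  rw [mem_ball_iff_norm, show v₀ + x • α + y - v₀ = x • α + y by abel]
  have h1 : ‖x • α‖ ≤ η / 2 := by
    rw [norm_smul, Real.norm_eq_abs]
    have hx' : |x| ≤ η / (2 * (‖α‖ + 1)) := abs_le.2 hx
    calc |x| * ‖α‖ ≤ η / (2 * (‖α‖ + 1)) * (‖α‖ + 1) := by gcongr; linarith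
      _ = η / 2 := by field_simp
  linarith [norm_add_le (x • α) y]

lemma hasDerivAt_line {w : E → ℝ} {v₀ α y : E} {x : ℝ}
    (h : DifferentiableAt ℝ w (v₀ + x • α + y)) :
    HasDerivAt (fun x : ℝ => w (v₀ + x • α + y)) (fderiv ℝ w (v₀ + x • α + y) α) x := by
  have h1 : HasDerivAt (fun x : ℝ => v₀ + x • α + y) α x := by
    simpa using (((hasDerivAt_id x).smul_const α).const_add v₀).add_const y
  exact h.hasFDerivAt.comp_hasDerivAt x h1

lemma differentiableAt_slice {u : ℝ × E → ℝ} {s : ℝ} {v : E} (h : DifferentiableAt ℝ u (s, v)) :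
    DifferentiableAt ℝ (fun v => u (s, v)) v :=
  DifferentiableAt.comp v h (by fun_prop)

lemma fderiv_slice {u : ℝ × E → ℝ} {s : ℝ} {v : E} (h : DifferentiableAt ℝ u (s, v)) (α : E) :
    fderiv ℝ (fun v => u (s, v)) v α = fderiv ℝ u (s, v) (0, α) := by
  have h1 : HasFDerivAt (fun v : E => (s, v)) (ContinuousLinearMap.inr ℝ ℝ E) v :=
    hasFDerivAt_prodMk_right s v
  have h2 : HasFDerivAt (fun v => u (s, v)) _ v := h.hasFDerivAt.comp v h1
  rw [h2.fderiv]
  simp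

/-- The zero set of a function with positive derivative along `α` is locally connected, uniformly
in a parameter. -/
lemma exists_open_isConnected_zeros_of_pos {u : ℝ × E → ℝ} {s₀ : ℝ} {v₀ α : E} {W : Set E}
    (hu : ContDiffAt ℝ 1 u (s₀, v₀)) (h0 : u (s₀, v₀) = 0)
    (hα : 0 < fderiv ℝ u (s₀, v₀) (0, α)) (hW : W ∈ 𝓝 v₀) :
    ∃ V, IsOpen V ∧ v₀ ∈ V ∧ V ⊆ W ∧ ∀ᶠ s in 𝓝 s₀, IsConnected ({v | u (s, v) = 0} ∩ V) := by
  have hα0 : α ≠ 0 := by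
    rintro rfl
    exact hα.ne' ((fderiv ℝ u (s₀, v₀)).map_zero)
  have hev : ∀ᶠ z in 𝓝 s₀ ×ˢ 𝓝 v₀,
      ContDiffAt ℝ 1 u z ∧ 0 < fderiv ℝ u z (0, α) ∧ z.2 ∈ W := by
    rw [← nhds_prod_eq]
    refine (hu.eventually (by simp)).and (Eventually.and ?_ ?_)
    · exact ((hu.continuousAt_fderiv one_ne_zero).clm_apply continuousAt_const).eventually
        (lt_mem_nhds hα)
    · exact continuousAt_snd.eventually hW
  obtain ⟨η, hη, hball⟩ := exists_pos_eventually_forall_ball hev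
  obtain ⟨ε, hε, hbox⟩ := exists_side_length α hη
  have hmono : ∀ s, (∀ v ∈ Metric.ball v₀ η,
      ContDiffAt ℝ 1 u (s, v) ∧ 0 < fderiv ℝ u (s, v) (0, α) ∧ v ∈ W) →
      ∀ y ∈ Metric.ball (0 : E) (η / 2),
      StrictMonoOn (fun x : ℝ => u (s, v₀ + x • α + y)) (Icc (-ε) ε) ∧
      ContinuousOn (fun x : ℝ => u (s, v₀ + x • α + y)) (Icc (-ε) ε) := by
    intro s hs y hy
    have hd : ∀ x ∈ Icc (-ε) ε, HasDerivAt (fun x : ℝ => u (s, v₀ + x • α + y))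
        (fderiv ℝ u (s, v₀ + x • α + y) (0, α)) x := by
      intro x hx
      have hdiff := (hs _ (hbox v₀ x hx y hy)).1.differentiableAt one_ne_zero
      rw [← fderiv_slice hdiff]
      exact hasDerivAt_line (differentiableAt_slice hdiff)
    have hc : ContinuousOn (fun x : ℝ => u (s, v₀ + x • α + y)) (Icc (-ε) ε) :=
      fun x hx => (hd x hx).continuousAt.continuousWithinAt
    refine ⟨strictMonoOn_of_deriv_pos (convex_Icc _ _) hc fun x hx => ?_, hc⟩
    have hx' := interior_subset hx
    rw [(hd x hx').deriv]
    exact (hs _ (hbox v₀ x hx' y hy)).2.1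
  have hs₀ := hball.self_of_nhds
  have h0η : (0 : E) ∈ Metric.ball (0 : E) (η / 2) := by simp [hη]
  have hsgn : 0 < u (s₀, v₀ + ε • α + 0) ∧ u (s₀, v₀ + (-ε) • α + 0) < 0 := by
    have hm := (hmono s₀ hs₀ 0 h0η).1
    have h1 := hm (a := 0) (b := ε) ⟨by linarith, hε.le⟩ ⟨by linarith, le_rfl⟩ hε
    have h2 := hm (a := -ε) (b := 0) ⟨le_rfl, by linarith⟩ ⟨by linarith, hε.le⟩ (by linarith)
    simp only [zero_smul, add_zero, h0] at h1 h2 ⊢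
    exact ⟨h1, h2⟩
  -- The strict signs at the two ends of the central segment persist for nearby parameters and
  -- parallel segments, so each of these has a zero, unique by monotonicity.
  have hend : ∀ᶠ z in 𝓝 s₀ ×ˢ 𝓝 (0 : E),
      0 < u (z.1, v₀ + ε • α + z.2) ∧ u (z.1, v₀ + (-ε) • α + z.2) < 0 := by
    rw [← nhds_prod_eq]
    have hc : ∀ x ∈ Icc (-ε) ε,
        ContinuousAt (fun z : ℝ × E => u (z.1, v₀ + x • α + z.2)) (s₀, 0) := fun x hx =>
      ContinuousAt.comp (f := fun z : ℝ × E => (z.1, v₀ + x • α + z.2))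
        (hs₀ _ (hbox v₀ x hx 0 h0η)).1.continuousAt (by fun_prop)
    exact ((hc ε ⟨by linarith, le_rfl⟩).eventually (lt_mem_nhds hsgn.1)).and
      ((hc (-ε) ⟨le_rfl, by linarith⟩).eventually (gt_mem_nhds hsgn.2))
  obtain ⟨δ, hδ, hends⟩ := exists_pos_eventually_forall_ball hend
  obtain ⟨V, Y, hVo, hv₀V, hY, hYδ, hV⟩ := exists_open_box hα0 v₀ hε (lt_min hδ (half_pos hη))
  have hYη : Y ⊆ Metric.ball 0 (η / 2) :=
    hYδ.trans (Metric.ball_subset_ball (min_le_right _ _))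
  have hVη : V ⊆ Metric.ball v₀ η := by
    rw [hV]
    rintro _ ⟨x, hx, y, hy, rfl⟩
    exact hbox v₀ x (Ioo_subset_Icc_self hx) y (hYη hy)
  refine ⟨V, hVo, hv₀V, fun v hv => (hs₀ v (hVη hv)).2.2, ?_⟩
  filter_upwards [hball, hends] with s hs hse
  have hco : ContinuousOn (fun v => u (s, v)) (Metric.ball v₀ η) := fun v hv =>
    (differentiableAt_slice
      ((hs v hv).1.differentiableAt one_ne_zero)).continuousAt.continuousWithinAt
  have hconn := isConnected_graph (α := α) (v₀ := v₀) (ε := ε) hY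
    (hco.isOpen_inter_preimage Metric.isOpen_ball isOpen_Ioi)
    (hco.isOpen_inter_preimage Metric.isOpen_ball isOpen_Iio) (P := _ ∩ _ ⁻¹' Ioi 0)
    (N := _ ∩ _ ⁻¹' Iio 0)
    (disjoint_left.2 fun v h1 h2 => lt_asymm (show u (s, v) < 0 from h1.2) h2.2) ?_
  · rw [← hV] at hconn
    convert hconn using 1
    ext v
    constructor
    · rintro ⟨h1, h2⟩
      have h1' : u (s, v) = 0 := h1
      exact ⟨h2, fun h => (show u (s, v) < 0 from h.2).ne h1',
        fun h => (show 0 < u (s, v) from h.2).ne' h1'⟩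
    · rintro ⟨h1, h2, h3⟩
      refine ⟨le_antisymm ?_ ?_, h1⟩
      · by_contra! h
        exact h3 ⟨hVη h1, h⟩
      · by_contra! h
        exact h2 ⟨hVη h1, h⟩
  · intro y hy
    have hyδ : y ∈ Metric.ball (0 : E) δ := Metric.ball_subset_ball (min_le_left _ _) (hYδ hy)
    obtain ⟨hm, hc⟩ := hmono s hs y (hYη hy)
    obtain ⟨r, hr, hr0⟩ := intermediate_value_Ioo (by linarith) hc
      ⟨(hse y hyδ).2, (hse y hyδ).1⟩
    have hr0' : u (s, v₀ + r • α + y) = 0 := hr0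
    have hrc := Ioo_subset_Icc_self hr
    refine ⟨r, hr, fun h => (show u (s, _) < 0 from h.2).ne hr0',
      fun h => (show 0 < u (s, _) from h.2).ne' hr0', fun x hx => ?_, fun x hx => ?_⟩
    · have hxc : x ∈ Icc (-ε) ε := ⟨hx.1.le, (hx.2.trans hr.2).le⟩
      exact ⟨hbox v₀ x hxc y (hYη hy), (hm hxc hrc hx.2).trans_eq hr0'⟩
    · have hxc : x ∈ Icc (-ε) ε := ⟨(hr.1.trans hx.1).le, hx.2.le⟩
      exact ⟨hbox v₀ x hxc y (hYη hy), hr0'.symm.trans_lt (hm hrc hxc hx.1)⟩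

lemma exists_open_isConnected_zeros {u : ℝ × E → ℝ} {s₀ : ℝ} {v₀ α : E} {W : Set E}
    (hu : ContDiffAt ℝ 1 u (s₀, v₀)) (h0 : u (s₀, v₀) = 0)
    (hα : fderiv ℝ u (s₀, v₀) (0, α) ≠ 0) (hW : W ∈ 𝓝 v₀) :
    ∃ V, IsOpen V ∧ v₀ ∈ V ∧ V ⊆ W ∧ ∀ᶠ s in 𝓝 s₀, IsConnected ({v | u (s, v) = 0} ∩ V) := by
  rcases hα.lt_or_gt with h | h
  · refine exists_open_isConnected_zeros_of_pos hu h0 (α := -α) ?_ hW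
    rw [show ((0 : ℝ), -α) = -(0, α) by simp, map_neg]
    linarith
  · exact exists_open_isConnected_zeros_of_pos hu h0 h hW

/-- A function on `[-ε, ε]` which is convex, negative at the zero of an increasing function `ρ` and
positive at `ε` has a unique zero to the right of the zero of `ρ`. -/
lemma exists_zero_of_convexOn {φ ρ : ℝ → ℝ} {ε : ℝ} (hε : 0 < ε) (hφ : ConvexOn ℝ (Icc (-ε) ε) φ)
    (hφc : ContinuousOn φ (Icc (-ε) ε)) (hρ : StrictMonoOn ρ (Icc (-ε) ε))
    (hρc : ContinuousOn ρ (Icc (-ε) ε)) (hρ₁ : ρ (-ε) < 0) (hρ₂ : 0 < ρ ε) (hφε : 0 < φ ε)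
    (hneg : ∀ x ∈ Icc (-ε) ε, ρ x = 0 → φ x < 0) :
    ∃ r ∈ Ioo (-ε) ε, φ r = 0 ∧ 0 < ρ r ∧ (∀ x ∈ Ioo (-ε) r, ρ x < 0 ∨ φ x < 0) ∧
      ∀ x ∈ Ioo r ε, 0 < ρ x ∧ 0 < φ x := by
  obtain ⟨x₀, hx₀, hρ0⟩ := intermediate_value_Ioo (by linarith) hρc ⟨hρ₁, hρ₂⟩
  have hx₀c := Ioo_subset_Icc_self hx₀
  have hφ0 := hneg x₀ hx₀c hρ0
  obtain ⟨r, hr, hr0⟩ := intermediate_value_Ioo hx₀.2.le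
    (hφc.mono (Icc_subset_Icc_left hx₀c.1)) ⟨hφ0, hφε⟩
  have hrc : r ∈ Icc (-ε) ε := ⟨(hx₀.1.trans hr.1).le, hr.2.le⟩
  have hρr : 0 < ρ r := hρ0 ▸ hρ hx₀c hrc hr.1
  refine ⟨r, ⟨hx₀.1.trans hr.1, hr.2⟩, hr0, hρr, fun x hx => ?_, fun x hx => ?_⟩
  · have hxc : x ∈ Icc (-ε) ε := ⟨hx.1.le, (hx.2.trans hr.2).le⟩
    rcases lt_trichotomy x x₀ with h | h | h
    · exact Or.inl (hρ0 ▸ hρ hxc hx₀c h)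
    · exact Or.inr (h ▸ hφ0)
    · right
      -- A convex function that is negative at `x₀` and vanishes at `r` is negative between them,
      -- and, by the same inequality below, positive beyond `r`.
      have h1 := hφ.secant_mono_aux1 hx₀c hrc h hx.2
      rw [hr0] at h1
      have h2 : (r - x) * φ x₀ < 0 := mul_neg_of_pos_of_neg (by linarith [hx.2]) hφ0
      by_contra! h3
      have := mul_nonneg (by linarith [hr.1] : 0 ≤ r - x₀) h3
      linarith
  · have hxc : x ∈ Icc (-ε) ε := ⟨by linarith [hrc.1, hx.1], hx.2.le⟩
    refine ⟨hρr.trans (hρ hrc hxc hx.1), ?_⟩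
    have h1 := hφ.secant_mono_aux1 hx₀c hxc hr.1 hx.1
    rw [hr0] at h1
    have h2 : (x - r) * φ x₀ < 0 := mul_neg_of_pos_of_neg (by linarith [hx.1]) hφ0
    by_contra! h3
    have := mul_nonpos_of_nonneg_of_nonpos (by linarith [hr.1] : 0 ≤ r - x₀) h3
    linarith

/-- Apply `isConnected_graph` to the regions `ρ < 0 ∨ w < 0` and `ρ > 0 ∧ w > 0`. Since `w` is
negative where `ρ` vanishes, the points in neither region are the zeros of `w` with `ρ > 0`, and
convexity leaves one of them on each line. -/
lemma isConnected_zeros_of_convexOn {w ρ : E → ℝ} {O Y : Set E} (hO : IsOpen O)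
    (hw : ContinuousOn w O) (hρ : ContinuousOn ρ O) (hY : IsConnected Y) {v₀ α : E} {ε : ℝ}
    (hε : 0 < ε) (hbox : ∀ x ∈ Icc (-ε) ε, ∀ y ∈ Y, v₀ + x • α + y ∈ O)
    (hconv : ∀ y ∈ Y, ConvexOn ℝ (Icc (-ε) ε) fun x : ℝ => w (v₀ + x • α + y))
    (hmono : ∀ y ∈ Y, StrictMonoOn (fun x : ℝ => ρ (v₀ + x • α + y)) (Icc (-ε) ε))
    (hρ₁ : ∀ y ∈ Y, ρ (v₀ + (-ε) • α + y) < 0) (hρ₂ : ∀ y ∈ Y, 0 < ρ (v₀ + ε • α + y))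
    (hwε : ∀ y ∈ Y, 0 < w (v₀ + ε • α + y)) (hneg : ∀ v ∈ O, ρ v = 0 → w v < 0) :
    IsConnected ({v | ∃ x ∈ Ioo (-ε) ε, ∃ y ∈ Y, v = v₀ + x • α + y} ∩
      {v | w v = 0 ∧ 0 < ρ v}) := by
  have hρN := hρ.isOpen_inter_preimage hO (isOpen_Iio (a := (0 : ℝ)))
  have hρP := hρ.isOpen_inter_preimage hO (isOpen_Ioi (a := (0 : ℝ)))
  have hwN := hw.isOpen_inter_preimage hO (isOpen_Iio (a := (0 : ℝ)))
  have hwP := hw.isOpen_inter_preimage hO (isOpen_Ioi (a := (0 : ℝ)))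
  have hdisj : Disjoint ((O ∩ ρ ⁻¹' Iio 0) ∪ (O ∩ w ⁻¹' Iio 0))
      ((O ∩ ρ ⁻¹' Ioi 0) ∩ (O ∩ w ⁻¹' Ioi 0)) := by
    refine disjoint_left.2 ?_
    rintro v (h | h) h'
    · exact lt_asymm (show ρ v < 0 from h.2) h'.1.2
    · exact lt_asymm (show w v < 0 from h.2) h'.2.2
  have hconn := isConnected_graph (α := α) (v₀ := v₀) (ε := ε) hY (hρP.inter hwP)
    (hρN.union hwN) hdisj ?_
  · convert hconn using 1
    ext v
    refine and_congr_right ?_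
    rintro ⟨x, hx, y, hy, rfl⟩
    have hvO := hbox x (Ioo_subset_Icc_self hx) y hy
    generalize v₀ + x • α + y = v at hvO
    constructor
    · rintro ⟨h1, h2⟩
      refine ⟨?_, fun h => (show 0 < w v from h.2.2).ne' h1⟩
      rintro (h | h)
      · exact lt_asymm (show ρ v < 0 from h.2) h2
      · exact (show w v < 0 from h.2).ne h1
    · rintro ⟨h1, h2⟩
      have hρ0 : 0 ≤ ρ v := by
        by_contra! h
        exact h1 (Or.inl ⟨hvO, h⟩)
      have hw0 : 0 ≤ w v := by
        by_contra! h
        exact h1 (Or.inr ⟨hvO, h⟩)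
      have hρ1 : 0 < ρ v := lt_of_le_of_ne hρ0 fun h => (hneg v hvO h.symm).not_ge hw0
      refine ⟨le_antisymm ?_ hw0, hρ1⟩
      by_contra! h
      exact h2 ⟨⟨hvO, hρ1⟩, ⟨hvO, h⟩⟩
  · intro y hy
    have hline : ContinuousOn (fun x : ℝ => v₀ + x • α + y) (Icc (-ε) ε) := by fun_prop
    have hmaps : MapsTo (fun x : ℝ => v₀ + x • α + y) (Icc (-ε) ε) O := fun x hx => hbox x hx y hy
    obtain ⟨r, hr, hr0, hρr, hlt, hgt⟩ := exists_zero_of_convexOn hε (hconv y hy)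
      (hw.comp hline hmaps) (hmono y hy) (hρ.comp hline hmaps) (hρ₁ y hy) (hρ₂ y hy) (hwε y hy)
      (fun x hx => hneg _ (hbox x hx y hy))
    have hrO := hbox r (Ioo_subset_Icc_self hr) y hy
    refine ⟨r, hr, ?_, fun h => (show 0 < w _ from h.2.2).ne' hr0, fun x hx => ?_, fun x hx => ?_⟩
    · rintro (h | h)
      · exact lt_asymm (show ρ _ < 0 from h.2) hρr
      · exact (show w _ < 0 from h.2).ne hr0
    · have hxO := hbox x ⟨hx.1.le, (hx.2.trans hr.2).le⟩ y hy
      exact (hlt x hx).imp (fun h => ⟨hxO, h⟩) fun h => ⟨hxO, h⟩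
    · have hxO := hbox x ⟨(hr.1.trans hx.1).le, hx.2.le⟩ y hy
      exact ⟨⟨hxO, (hgt x hx).1⟩, ⟨hxO, (hgt x hx).2⟩⟩

/-- If `u (s₀, ·)` is a square `ρ ^ 2` and `u (s, ·)` is negative on the zero set of `ρ`, then
`u (s, ·)` has locally one connected sheet of zeros on each side of the zero set of `ρ`. -/
lemma exists_open_isConnected_sides {u : ℝ × E → ℝ} {ρ : E → ℝ} {s₀ : ℝ} {v₀ α : E} {W : Set E}
    {l : Filter ℝ} (hl : l ≤ 𝓝 s₀) (hu : ContDiffAt ℝ 2 u (s₀, v₀)) (hρ : ContDiffAt ℝ 2 ρ v₀)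
    (h0 : ρ v₀ = 0) (huρ : ∀ᶠ v in 𝓝 v₀, u (s₀, v) = ρ v ^ 2) (hα : 0 < fderiv ℝ ρ v₀ α)
    (hneg : ∀ᶠ z in l ×ˢ 𝓝 v₀, ρ z.2 = 0 → u z < 0) (hW : W ∈ 𝓝 v₀) :
    ∃ V, IsOpen V ∧ v₀ ∈ V ∧ V ⊆ W ∧ ∀ᶠ s in l, IsConnected (V ∩ {v | u (s, v) = 0 ∧ 0 < ρ v}) ∧
      IsConnected (V ∩ {v | u (s, v) = 0 ∧ ρ v < 0}) ∧ ∀ v ∈ V, ρ v = 0 → u (s, v) < 0 := by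
  have hα0 : α ≠ 0 := by
    rintro rfl
    exact hα.ne' ((fderiv ℝ ρ v₀).map_zero)
  let u₁ : ℝ × E → ℝ := fun z => fderiv ℝ u z (0, α)
  have hu₁d : ContDiffAt ℝ 1 u₁ (s₀, v₀) :=
    (hu.fderiv_right (m := 1) (by norm_num)).clm_apply contDiffAt_const
  have hρev : ∀ᶠ v in 𝓝 v₀, ContDiffAt ℝ 2 ρ v := hρ.eventually (by simp)
  have huev : ∀ᶠ z in 𝓝 (s₀, v₀), ContDiffAt ℝ 2 u z := hu.eventually (by simp)
  have hslice : Tendsto (fun v : E => (s₀, v)) (𝓝 v₀) (𝓝 (s₀, v₀)) := by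
    exact (by fun_prop : Continuous fun v : E => (s₀, v)).tendsto v₀
  have hu₁ρ : ∀ᶠ v in 𝓝 v₀, u₁ (s₀, v) = 2 * ρ v * fderiv ℝ ρ v α := by
    filter_upwards [huρ.eventually_nhds, hρev, hslice.eventually huev] with v hv hρv huv
    have hsq : HasFDerivAt (fun v => ρ v ^ 2) _ v :=
      (hρv.differentiableAt two_ne_zero).hasFDerivAt.pow 2
    change fderiv ℝ u (s₀, v) (0, α) = _
    rw [← fderiv_slice (huv.differentiableAt two_ne_zero), EventuallyEq.fderiv_eq hv, hsq.fderiv]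
    simp [mul_assoc]
  -- Where `ρ = 0`, the second derivative of `ρ ^ 2` along `α` is twice the square of the first
  -- derivative of `ρ`. It is positive, so `u (s, ·)` is convex on short segments along `α` for all
  -- nearby `s`.
  have hu₂ : 0 < fderiv ℝ u₁ (s₀, v₀) (0, α) := by
    have hρ₁ : DifferentiableAt ℝ (fun v => fderiv ℝ ρ v α) v₀ :=
      ((hρ.fderiv_right (m := 1) (by norm_num)).clm_apply contDiffAt_const).differentiableAt
        one_ne_zero
    have h1 : HasFDerivAt (fun v => 2 * ρ v * fderiv ℝ ρ v α) _ v₀ :=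
      ((hρ.differentiableAt two_ne_zero).hasFDerivAt.const_mul 2).mul hρ₁.hasFDerivAt
    rw [← fderiv_slice (hu₁d.differentiableAt one_ne_zero), EventuallyEq.fderiv_eq hu₁ρ, h1.fderiv]
    simp only [h0]
    simp
    positivity
  have hev : ∀ᶠ z in 𝓝 s₀ ×ˢ 𝓝 v₀, ContDiffAt ℝ 2 u z ∧ ContDiffAt ℝ 1 u₁ z ∧
      0 < fderiv ℝ u₁ z (0, α) ∧ ContDiffAt ℝ 2 ρ z.2 ∧ 0 < fderiv ℝ ρ z.2 α ∧
      u (s₀, z.2) = ρ z.2 ^ 2 ∧ z.2 ∈ W := by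
    rw [← nhds_prod_eq]
    have hsnd : Tendsto (Prod.snd : ℝ × E → E) (𝓝 (s₀, v₀)) (𝓝 v₀) := continuousAt_snd
    refine huev.and ((hu₁d.eventually (by simp)).and (.and ?_ ((hsnd.eventually hρev).and
      (.and ?_ ((hsnd.eventually huρ).and (hsnd.eventually hW))))))
    · exact ((hu₁d.continuousAt_fderiv one_ne_zero).clm_apply continuousAt_const).eventually
        (lt_mem_nhds hu₂)
    · exact hsnd.eventually (((hρ.continuousAt_fderiv two_ne_zero).clm_apply
        continuousAt_const).eventually (lt_mem_nhds hα))
  obtain ⟨η₁, hη₁, hball₁⟩ := exists_pos_eventually_forall_ball hev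
  obtain ⟨η₂, hη₂, hball₂⟩ := exists_pos_eventually_forall_ball hneg
  set η := min η₁ η₂
  have hη : 0 < η := lt_min hη₁ hη₂
  have hb₁ : Metric.ball v₀ η ⊆ Metric.ball v₀ η₁ := Metric.ball_subset_ball (min_le_left _ _)
  have hb₂ : Metric.ball v₀ η ⊆ Metric.ball v₀ η₂ := Metric.ball_subset_ball (min_le_right _ _)
  obtain ⟨ε, hε, hbox⟩ := exists_side_length α hη
  have hs₀ := hball₁.self_of_nhds
  have h0η : (0 : E) ∈ Metric.ball (0 : E) (η / 2) := by simp [hη]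
  have hεc : ε ∈ Icc (-ε) ε := ⟨by linarith, le_rfl⟩
  have hεc' : -ε ∈ Icc (-ε) ε := ⟨le_rfl, by linarith⟩
  have hmono : ∀ y ∈ Metric.ball (0 : E) (η / 2),
      StrictMonoOn (fun x : ℝ => ρ (v₀ + x • α + y)) (Icc (-ε) ε) := by
    intro y hy
    have hd : ∀ x ∈ Icc (-ε) ε, HasDerivAt (fun x : ℝ => ρ (v₀ + x • α + y))
        (fderiv ℝ ρ (v₀ + x • α + y) α) x := fun x hx =>
      hasDerivAt_line ((hs₀ _ (hb₁ (hbox v₀ x hx y hy))).2.2.2.1.differentiableAt two_ne_zero)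
    refine strictMonoOn_of_deriv_pos (convex_Icc _ _)
      (fun x hx => (hd x hx).continuousAt.continuousWithinAt) fun x hx => ?_
    have hx' := interior_subset hx
    rw [(hd x hx').deriv]
    exact (hs₀ _ (hb₁ (hbox v₀ x hx' y hy))).2.2.2.2.1
  have hsgn : 0 < ρ (v₀ + ε • α + 0) ∧ ρ (v₀ + (-ε) • α + 0) < 0 := by
    have hm := hmono 0 h0η
    have h1 := hm (a := 0) (b := ε) ⟨by linarith, hε.le⟩ hεc hε
    have h2 := hm (a := -ε) (b := 0) hεc' ⟨by linarith, hε.le⟩ (by linarith)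
    simp only [zero_smul, add_zero, h0] at h1 h2 ⊢
    exact ⟨h1, h2⟩
  have hend : ∀ᶠ z in 𝓝 s₀ ×ˢ 𝓝 (0 : E),
      (0 < ρ (v₀ + ε • α + z.2) ∧ ρ (v₀ + (-ε) • α + z.2) < 0) ∧
      0 < u (z.1, v₀ + ε • α + z.2) ∧ 0 < u (z.1, v₀ + (-ε) • α + z.2) := by
    rw [← nhds_prod_eq]
    have hc : ∀ x ∈ Icc (-ε) ε,
        ContinuousAt (fun z : ℝ × E => u (z.1, v₀ + x • α + z.2)) (s₀, 0) := fun x hx =>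
      ContinuousAt.comp (f := fun z : ℝ × E => (z.1, v₀ + x • α + z.2))
        (hs₀ _ (hb₁ (hbox v₀ x hx 0 h0η))).1.continuousAt (by fun_prop)
    have hcρ : ∀ x ∈ Icc (-ε) ε,
        ContinuousAt (fun z : ℝ × E => ρ (v₀ + x • α + z.2)) (s₀, 0) := fun x hx =>
      ContinuousAt.comp (f := fun z : ℝ × E => v₀ + x • α + z.2)
        (hs₀ _ (hb₁ (hbox v₀ x hx 0 h0η))).2.2.2.1.continuousAt (by fun_prop)
    -- At the ends of the box `ρ ≠ 0`, hence `ρ ^ 2 > 0`; this is the positivity beyond both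
    -- expected zeros.
    have hpos : ∀ x ∈ Icc (-ε) ε, ρ (v₀ + x • α + 0) ≠ 0 → 0 < u (s₀, v₀ + x • α + 0) := by
      intro x hx hne
      have hsq : u (s₀, v₀ + x • α + 0) = ρ (v₀ + x • α + 0) ^ 2 :=
        (hs₀ _ (hb₁ (hbox v₀ x hx 0 h0η))).2.2.2.2.2.1
      rw [hsq]
      positivity
    exact (((hcρ ε hεc).eventually (lt_mem_nhds hsgn.1)).and
      ((hcρ (-ε) hεc').eventually (gt_mem_nhds hsgn.2))).and
      (((hc ε hεc).eventually (lt_mem_nhds (hpos ε hεc hsgn.1.ne'))).and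
      ((hc (-ε) hεc').eventually (lt_mem_nhds (hpos (-ε) hεc' hsgn.2.ne))))
  obtain ⟨δ, hδ, hends⟩ := exists_pos_eventually_forall_ball hend
  obtain ⟨V, Y, hVo, hv₀V, hY, hYδ, hV⟩ := exists_open_box hα0 v₀ hε (lt_min hδ (half_pos hη))
  have hYη : Y ⊆ Metric.ball 0 (η / 2) := hYδ.trans (Metric.ball_subset_ball (min_le_right _ _))
  have hYδ' : Y ⊆ Metric.ball 0 δ := hYδ.trans (Metric.ball_subset_ball (min_le_left _ _))
  have hVη : V ⊆ Metric.ball v₀ η := by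
    rw [hV]
    rintro _ ⟨x, hx, y, hy, rfl⟩
    exact hbox v₀ x (Ioo_subset_Icc_self hx) y (hYη hy)
  refine ⟨V, hVo, hv₀V, fun v hv => (hs₀ v (hb₁ (hVη hv))).2.2.2.2.2.2, ?_⟩
  filter_upwards [hl hball₁, hball₂, hl hends] with s hs hsn hse
  have hcu : ContinuousOn (fun v => u (s, v)) (Metric.ball v₀ η) := fun v hv =>
    (differentiableAt_slice
      ((hs v (hb₁ hv)).1.differentiableAt two_ne_zero)).continuousAt.continuousWithinAt
  have hcρ : ContinuousOn ρ (Metric.ball v₀ η) := fun v hv =>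
    (hs₀ v (hb₁ hv)).2.2.2.1.continuousAt.continuousWithinAt
  have hnegη : ∀ v ∈ Metric.ball v₀ η, ρ v = 0 → u (s, v) < 0 := fun v hv => hsn v (hb₂ hv)
  have hconv : ∀ y ∈ Y, ConvexOn ℝ (Icc (-ε) ε) fun x : ℝ => u (s, v₀ + x • α + y) := by
    intro y hy
    have hd : ∀ x ∈ Icc (-ε) ε, HasDerivAt (fun x : ℝ => u (s, v₀ + x • α + y))
        (u₁ (s, v₀ + x • α + y)) x := by
      intro x hx
      have hdiff := (hs _ (hb₁ (hbox v₀ x hx y (hYη hy)))).1.differentiableAt two_ne_zero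
      change HasDerivAt _ (fderiv ℝ u (s, v₀ + x • α + y) (0, α)) x
      rw [← fderiv_slice hdiff]
      exact hasDerivAt_line (differentiableAt_slice hdiff)
    have hd' : ∀ x ∈ Icc (-ε) ε, HasDerivAt (fun x : ℝ => u₁ (s, v₀ + x • α + y))
        (fderiv ℝ u₁ (s, v₀ + x • α + y) (0, α)) x := by
      intro x hx
      have hdiff := (hs _ (hb₁ (hbox v₀ x hx y (hYη hy)))).2.1.differentiableAt one_ne_zero
      rw [← fderiv_slice hdiff]
      exact hasDerivAt_line (w := fun v => u₁ (s, v)) (differentiableAt_slice hdiff)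
    exact convexOn_of_hasDerivWithinAt2_nonneg (convex_Icc _ _)
      (fun x hx => (hd x hx).continuousAt.continuousWithinAt)
      (fun x hx => (hd x (interior_subset hx)).hasDerivWithinAt)
      (fun x hx => (hd' x (interior_subset hx)).hasDerivWithinAt)
      (fun x hx => (hs _ (hb₁ (hbox v₀ x (interior_subset hx) y (hYη hy)))).2.2.1.le)
  have hneg_mem : ∀ x ∈ Icc (-ε) ε, -x ∈ Icc (-ε) ε := fun x hx =>
    ⟨by linarith [hx.2], by linarith [hx.1]⟩
  refine ⟨?_, ?_, fun v hv => hnegη v (hVη hv)⟩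
  · have := isConnected_zeros_of_convexOn Metric.isOpen_ball hcu hcρ hY hε
      (fun x hx y hy => hbox v₀ x hx y (hYη hy)) hconv (fun y hy => hmono y (hYη hy))
      (fun y hy => (hse y (hYδ' hy)).1.2) (fun y hy => (hse y (hYδ' hy)).1.1)
      (fun y hy => (hse y (hYδ' hy)).2.1) hnegη
    rwa [← hV] at this
  -- The other side follows by reversing both the direction and the sign of `ρ`.
  · have := isConnected_zeros_of_convexOn (α := -α) (ρ := fun v => -ρ v) Metric.isOpen_ball hcu
      hcρ.neg hY hε
      (fun x hx y hy => by simpa using hbox v₀ (-x) (hneg_mem x hx) y (hYη hy))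
      (fun y hy => by
        have h := (hconv y hy).comp_linearMap (-LinearMap.id)
        refine (h.subset (s := Icc (-ε) ε) (fun x hx => hneg_mem x hx) (convex_Icc _ _)).congr ?_
        intro x _
        simp)
      (fun y hy a ha b hb hab => by
        simpa using hmono y (hYη hy) (hneg_mem b hb) (hneg_mem a ha) (neg_lt_neg hab))
      (fun y hy => by simpa using (hse y (hYδ' hy)).1.1)
      (fun y hy => by simpa using (hse y (hYδ' hy)).1.2)
      (fun y hy => by simpa using (hse y (hYδ' hy)).2.2)
      (fun v hv h => hnegη v hv (neg_eq_zero.1 h))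
    have hV' : {v | ∃ x ∈ Ioo (-ε) ε, ∃ y ∈ Y, v = v₀ + x • (-α) + y} = V := by
      rw [hV]
      ext v
      constructor
      · rintro ⟨x, hx, y, hy, rfl⟩
        exact ⟨-x, ⟨by linarith [hx.2], by linarith [hx.1]⟩, y, hy, by simp⟩
      · rintro ⟨x, hx, y, hy, rfl⟩
        exact ⟨-x, ⟨by linarith [hx.2], by linarith [hx.1]⟩, y, hy, by simp⟩
    rw [hV'] at this
    simpa using this

/-- The sign of the time derivative decides between values above and below the initial ones. -/
lemma eventually_lt_of_deriv_pos {u : ℝ × E → ℝ} {s₀ : ℝ} {v₀ : E}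
    (hu : ContDiffAt ℝ 1 u (s₀, v₀)) (hα : 0 < fderiv ℝ u (s₀, v₀) (1, 0)) :
    ∀ᶠ z in 𝓝 (s₀, v₀), (s₀ < z.1 → u (s₀, z.2) < u z) ∧ (z.1 < s₀ → u z < u (s₀, z.2)) := by
  -- Strict differentiability allows both compared points to move, which makes the estimate uniform
  -- in the space variable. An error of half the time derivative cannot change the sign.
  have h := hu.hasStrictFDerivAt one_ne_zero
  have hc : 0 < fderiv ℝ u (s₀, v₀) (1, 0) / 2 := by linarith
  have h1 := h.isLittleO.def hc
  have ht : Tendsto (fun z : ℝ × E => (z, ((s₀, z.2) : ℝ × E))) (𝓝 (s₀, v₀))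
      (𝓝 ((s₀, v₀), (s₀, v₀))) :=
    (by fun_prop : Continuous fun z : ℝ × E => (z, ((s₀, z.2) : ℝ × E))).tendsto (s₀, v₀)
  filter_upwards [ht.eventually h1] with z hz
  have hsub : z - (s₀, z.2) = (z.1 - s₀) • ((1 : ℝ), (0 : E)) := by
    ext <;> simp
  rw [hsub, map_smul, norm_smul, smul_eq_mul] at hz
  have hn : ‖((1 : ℝ), (0 : E))‖ = 1 := by simp [Prod.norm_def]
  rw [hn, mul_one, Real.norm_eq_abs, Real.norm_eq_abs] at hz
  generalize fderiv ℝ u (s₀, v₀) (1, 0) = a at *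
  obtain ⟨hz1, hz2⟩ := abs_le.1 hz
  constructor <;> intro hlt
  · rw [abs_of_pos (sub_pos.2 hlt)] at hz1
    nlinarith [mul_pos hc (sub_pos.2 hlt)]
  · rw [abs_of_neg (sub_neg.2 hlt)] at hz2
    nlinarith [mul_pos hc (sub_pos.2 hlt)]

end Flat

/-! ### Embedded spheres in charts: tangent planes and defining functions. -/

section Geometry

/-- The model space of the charts of the sphere. -/
abbrev E2 : Type := EuclideanSpace ℝ (Fin 2)

lemma IsSphereEmbedding.contMDiff {f : S2 → E3} (hf : IsSphereEmbedding f) :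
    ContMDiff (𝓡 2) (𝓡 3) ∞ f :=
  Manifold.IsSmoothEmbedding.contMDiff hf

lemma contDiffAt_comp_chart {f : S2 → E3} (hf : ContMDiff (𝓡 2) (𝓡 3) ∞ f) (p : S2) {v : E2}
    (hv : v ∈ (chartAt E2 p).target) : ContDiffAt ℝ ∞ (fun v => f ((chartAt E2 p).symm v)) v := by
  have h : ContMDiffOn (𝓡 2) (𝓡 3) ∞ (f ∘ (chartAt E2 p).symm) (chartAt E2 p).target :=
    hf.comp_contMDiffOn contMDiffOn_chart_symm
  exact (contMDiffOn_iff_contDiffOn.1 h).contDiffAt ((chartAt E2 p).open_target.mem_nhds hv)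

lemma contDiffAt_family_comp_chart {F : ℝ → S2 → E3}
    (hF : ContMDiff (𝓘(ℝ, ℝ).prod (𝓡 2)) (𝓡 3) ∞ (fun x : ℝ × S2 => F x.1 x.2)) (s : ℝ) (p : S2)
    {v : E2} (hv : v ∈ (chartAt E2 p).target) :
    ContDiffAt ℝ ∞ (fun z : ℝ × E2 => F z.1 ((chartAt E2 p).symm z.2)) (s, v) := by
  have h1 : ContMDiffOn (𝓘(ℝ, ℝ).prod (𝓡 2)) (𝓘(ℝ, ℝ).prod (𝓡 2)) ∞
      (Prod.map id (chartAt E2 p).symm : ℝ × E2 → ℝ × S2) (univ ×ˢ (chartAt E2 p).target) :=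
    contMDiffOn_id.prodMap contMDiffOn_chart_symm
  have h2 := hF.comp_contMDiffOn h1
  rw [← modelWithCornersSelf_prod, chartedSpaceSelf_prod] at h2
  exact (contMDiffOn_iff_contDiffOn.1 h2).contDiffAt
    ((isOpen_univ.prod (chartAt E2 p).open_target).mem_nhds ⟨mem_univ _, hv⟩)

lemma tangentImage_eq {f : S2 → E3} (hf : ContMDiff (𝓡 2) (𝓡 3) ∞ f) (p : S2) :
    tangentImage f p =
      (fderiv ℝ (fun v => f ((chartAt E2 p).symm v)) (chartAt E2 p p)).range := by
  have hd : MDifferentiableAt (𝓡 2) (𝓡 3) f p := hf.mdifferentiable (by simp) p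
  have key : ∀ w : E2, mvfderiv (𝓡 2) f p w =
      fderiv ℝ (fun v => f ((chartAt E2 p).symm v)) (chartAt E2 p p) w := by
    intro w
    change mfderiv (𝓡 2) (𝓡 3) f p w = _
    rw [hd.mfderiv]
    simp only [writtenInExtChartAt, mfld_simps, fderivWithin_univ]
    rfl
  ext x
  exact exists_congr fun w => ⟨fun h => (key w).symm.trans h, fun h => (key w).trans h⟩

lemma fderiv_bijective {ψ : OpenPartialHomeomorph E3 E3} (hψ : ContDiffOn ℝ ∞ ψ ψ.source)
    (hψ' : ContDiffOn ℝ ∞ ψ.symm ψ.target) {x : E3} (hx : x ∈ ψ.source) :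
    Function.Bijective (fderiv ℝ ψ x) := by
  have h1 := ((hψ.contDiffAt (ψ.open_source.mem_nhds hx)).differentiableAt (by simp)).hasFDerivAt
  have h2 := ((hψ'.contDiffAt (ψ.open_target.mem_nhds (ψ.map_source hx))).differentiableAt
    (by simp)).hasFDerivAt
  have h3 : HasFDerivAt (ψ.symm ∘ ψ) _ x := h2.comp x h1
  have h4 : HasFDerivAt (ψ.symm ∘ ψ) (ContinuousLinearMap.id ℝ E3) x :=
    (hasFDerivAt_id x).congr_of_eventuallyEq (ψ.eventually_left_inverse hx)
  have hinj : Function.Injective (fderiv ℝ ψ x) := by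
    refine Function.LeftInverse.injective (g := fderiv ℝ ψ.symm (ψ x)) fun v => ?_
    exact congrArg (fun L : E3 →L[ℝ] E3 => L v) (h3.unique h4)
  exact ⟨hinj, (LinearMap.injective_iff_surjective (f := (fderiv ℝ ψ x).toLinearMap)).1 hinj⟩

lemma codChart_apply {f : S2 → E3} {p : S2} (him : Manifold.IsImmersionAt (𝓡 2) (𝓡 3) ∞ f p)
    {p' : S2} (hp' : p' ∈ him.domChart.source) :
    him.codChart (f p') = him.equiv (him.domChart p', 0) := by
  have h := him.writtenInCharts
  simp only [EqOn, mfld_simps] at h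
  simpa [him.domChart.left_inv hp'] using h (him.domChart.map_source hp')

/-- The differential of an embedding is injective. -/
lemma IsSphereEmbedding.injective_fderiv {f : S2 → E3} (hf : IsSphereEmbedding f) (p : S2) :
    Function.Injective (fderiv ℝ (fun v => f ((chartAt E2 p).symm v)) (chartAt E2 p p)) := by
  have him := hf.isImmersion.isImmersionAt p
  set e := chartAt E2 p
  have hpe : p ∈ e.source := mem_chart_source E2 p
  have h1 := ((contDiffAt_comp_chart hf.contMDiff p (e.map_source hpe)).differentiableAt
    (by simp)).hasFDerivAt
  have hw : ∀ p' ∈ him.domChart.source,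
      him.codChart (f p') = him.equiv (him.domChart p', 0) := fun p' => codChart_apply him
  -- A smooth local left inverse of `f`, read in the chart: straighten the immersion to an
  -- inclusion, project to the first factor and return to the chart `e`.
  let R : E3 → E2 := fun x => e (him.domChart.symm (him.equiv.symm (him.codChart x)).1)
  have hfp : (him.equiv.symm (him.codChart (f p))).1 = him.domChart p := by
    rw [hw p him.mem_domChart_source]
    simp
  have hR : ContDiffAt ℝ ∞ R (f p) := by
    have a1 : ContDiffAt ℝ ∞ him.codChart (f p) :=
      (contMDiffOn_iff_contDiffOn.1 (contMDiffOn_of_mem_maximalAtlas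
        him.codChart_mem_maximalAtlas)).contDiffAt
        (him.codChart.open_source.mem_nhds him.mem_codChart_source)
    have a2 : ContDiffAt ℝ ∞ (fun x => (him.equiv.symm (him.codChart x)).1) (f p) :=
      contDiff_fst.contDiffAt.comp (f p) (him.equiv.symm.contDiff.contDiffAt.comp (f p) a1)
    have a3 : ContMDiffAt (𝓡 2) (𝓡 2) ∞ him.domChart.symm (him.domChart p) :=
      (contMDiffOn_symm_of_mem_maximalAtlas him.domChart_mem_maximalAtlas).contMDiffAt
        (him.domChart.open_target.mem_nhds (him.domChart.map_source him.mem_domChart_source))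
    have a4 : ContMDiffAt (𝓡 2) (𝓡 2) ∞ e (him.domChart.symm (him.domChart p)) := by
      rw [him.domChart.left_inv him.mem_domChart_source]
      exact contMDiffOn_chart.contMDiffAt (e.open_source.mem_nhds hpe)
    have a5 : ContDiffAt ℝ ∞ (e ∘ him.domChart.symm) (him.domChart p) :=
      contMDiffAt_iff_contDiffAt.1 (a4.comp (him.domChart p) a3)
    rw [← hfp] at a5
    exact ContDiffAt.comp (f p) (g := e ∘ him.domChart.symm) a5 a2
  have hpe' : e.symm (e p) = p := e.left_inv hpe
  have hR' : HasFDerivAt R (fderiv ℝ R (f p)) (f (e.symm (e p))) := by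
    rw [hpe']
    exact (hR.differentiableAt (by simp)).hasFDerivAt
  have h3 := hR'.comp (e p) h1
  have h4 : HasFDerivAt (R ∘ fun v => f (e.symm v)) (ContinuousLinearMap.id ℝ E2) (e p) := by
    refine (hasFDerivAt_id (e p)).congr_of_eventuallyEq ?_
    have ht : Tendsto e.symm (𝓝 (e p)) (𝓝 p) := by
      simpa [hpe'] using (e.symm.continuousAt (x := e p) (e.map_source hpe)).tendsto
    filter_upwards [ht.eventually (him.domChart.open_source.mem_nhds him.mem_domChart_source),
      e.open_target.mem_nhds (e.map_source hpe)] with v hv hv'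
    simp only [Function.comp, R, hw _ hv, ContinuousLinearEquiv.symm_apply_apply]
    rw [him.domChart.left_inv hv, e.right_inv hv', id]
  refine Function.LeftInverse.injective (g := fderiv ℝ R (f p)) fun w => ?_
  exact congrArg (fun L : E2 →L[ℝ] E2 => L w) (h3.unique h4)

/-- The image of an embedded sphere is locally the zero set of a submersion. -/
lemma IsSphereEmbedding.exists_defining {g : S2 → E3} (hg : IsSphereEmbedding g) (q : S2) :
    ∃ (U : Set E3) (h : E3 → ℝ), IsOpen U ∧ g q ∈ U ∧ ContDiffOn ℝ ∞ h U ∧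
      (∀ x ∈ U, x ∈ range g ↔ h x = 0) ∧ fderiv ℝ h (g q) ≠ 0 := by
  have him := hg.isImmersion.isImmersionAt q
  set ψ := him.codChart
  set φ := him.domChart
  have hψ : ContDiffOn ℝ ∞ ψ ψ.source := contMDiffOn_iff_contDiffOn.1
    (contMDiffOn_of_mem_maximalAtlas him.codChart_mem_maximalAtlas)
  have hψ' : ContDiffOn ℝ ∞ ψ.symm ψ.target := contMDiffOn_iff_contDiffOn.1
    (contMDiffOn_symm_of_mem_maximalAtlas him.codChart_mem_maximalAtlas)
  have hw : ∀ q' ∈ φ.source, ψ (g q') = him.equiv (φ q', 0) := fun q' => codChart_apply him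
  have : FiniteDimensional ℝ (E2 × him.complement) :=
    him.equiv.symm.toLinearEquiv.finiteDimensional
  have : FiniteDimensional ℝ him.complement :=
    Module.Finite.of_surjective (LinearMap.snd ℝ E2 him.complement) LinearMap.snd_surjective
  have hrank : Module.finrank ℝ him.complement = 1 := by
    have := him.equiv.toLinearEquiv.finrank_eq
    rw [Module.finrank_prod, finrank_euclideanSpace_fin, finrank_euclideanSpace_fin] at this
    omega
  let ℓ : him.complement ≃L[ℝ] ℝ := ContinuousLinearEquiv.ofFinrankEq (by simp [hrank])
  let L : E3 →L[ℝ] ℝ := (ℓ : him.complement →L[ℝ] ℝ) ∘L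
    (ContinuousLinearMap.snd ℝ E2 him.complement) ∘L (him.equiv.symm : E3 →L[ℝ] _)
  have hL : ∀ x, L x = ℓ (him.equiv.symm x).2 := fun x => rfl
  have hL0 : L ≠ 0 := fun h => by
    have h1 : L (him.equiv (0, ℓ.symm 1)) = 0 := by rw [h]; rfl
    simp [hL] at h1
  -- Here the topological embedding enters: points of the image inside `O` come only from the chart
  -- domain around `q`, so no other part of the sphere interferes.
  obtain ⟨O, hO, hOφ⟩ := hg.isEmbedding.isInducing.isOpen_iff.1 φ.open_source
  have hcont : ContinuousOn (fun x => (him.equiv.symm (ψ x)).1) ψ.source :=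
    (continuous_fst.comp him.equiv.symm.continuous).comp_continuousOn ψ.continuousOn
  -- The defining function is the normal coordinate. Requiring the first coordinates to lie in
  -- `φ.target` ensures that each of its zeros is the image of a point of the sphere.
  refine ⟨(ψ.source ∩ (fun x => (him.equiv.symm (ψ x)).1) ⁻¹' φ.target) ∩ O, fun x => L (ψ x),
    (hcont.isOpen_inter_preimage ψ.open_source φ.open_target).inter hO, ?_, ?_, ?_, ?_⟩
  · refine ⟨⟨him.mem_codChart_source, ?_⟩, ?_⟩
    · change (him.equiv.symm (ψ (g q))).1 ∈ φ.target
      rw [hw q him.mem_domChart_source]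
      simpa using φ.map_source him.mem_domChart_source
    · exact (Set.ext_iff.1 hOφ q).2 him.mem_domChart_source
  · exact L.contDiff.comp_contDiffOn (hψ.mono fun x hx => hx.1.1)
  · rintro x ⟨⟨hx1, hx2⟩, hxO⟩
    constructor
    · rintro ⟨q', rfl⟩
      have hq' : q' ∈ φ.source := (Set.ext_iff.1 hOφ q').1 hxO
      change L (ψ (g q')) = 0
      rw [hL, hw q' hq']
      simp
    · intro h0
      have hx2' : (him.equiv.symm (ψ x)).1 ∈ φ.target := hx2
      have h1 : (him.equiv.symm (ψ x)).2 = 0 := by simpa [hL] using h0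
      have hs := φ.map_target hx2'
      refine ⟨φ.symm (him.equiv.symm (ψ x)).1, ψ.injOn
        (him.source_subset_preimage_source hs) hx1 ?_⟩
      rw [hw _ hs, φ.right_inv hx2', ← h1]
      simp
  · have hd := (hψ.contDiffAt (ψ.open_source.mem_nhds him.mem_codChart_source)).differentiableAt
      (by simp)
    have hd' : HasFDerivAt (fun x => L (ψ x)) _ (g q) := L.hasFDerivAt.comp (g q) hd.hasFDerivAt
    rw [hd'.fderiv]
    intro h0
    refine hL0 (ContinuousLinearMap.ext fun x => ?_)
    obtain ⟨y, rfl⟩ := (fderiv_bijective hψ hψ' him.mem_codChart_source).2 x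
    exact congrArg (fun T : E3 →L[ℝ] ℝ => T y) h0

/-- The differential of `h ∘ f` vanishes at a local minimum. This serves both for functions
vanishing on a sphere, where `h ∘ f` is locally constant, and for the height `ρ ^ 2` at a tangency.
-/
lemma tangentImage_le_ker {f : S2 → E3} (hf : ContMDiff (𝓡 2) (𝓡 3) ∞ f) {p : S2} {h : E3 → ℝ}
    (hh : DifferentiableAt ℝ h (f p)) (hmin : IsLocalMin (fun p => h (f p)) p) :
    tangentImage f p ≤ (fderiv ℝ h (f p)).ker := by
  set e := chartAt E2 p
  have hpe : p ∈ e.source := mem_chart_source E2 p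
  have hpe' : e.symm (e p) = p := e.left_inv hpe
  have h1 := ((contDiffAt_comp_chart hf p (e.map_source hpe)).differentiableAt
    (by simp)).hasFDerivAt
  have hh' : HasFDerivAt h (fderiv ℝ h (f p)) (f (e.symm (e p))) := by
    rw [hpe']; exact hh.hasFDerivAt
  have h2 := hh'.comp (e p) h1
  have hmin' : IsLocalMin (h ∘ fun v => f (e.symm v)) (e p) := by
    have ht : Tendsto e.symm (𝓝 (e p)) (𝓝 p) := by
      simpa [hpe'] using (e.symm.continuousAt (x := e p) (e.map_source hpe)).tendsto
    have := ht.eventually hmin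
    filter_upwards [this] with v hv
    simpa [hpe'] using hv
  have h0 := hmin'.hasFDerivAt_eq_zero h2
  rw [tangentImage_eq hf]
  rintro _ ⟨w, rfl⟩
  exact congrArg (fun L : E2 →L[ℝ] ℝ => L w) h0

end Geometry

/-! ### The intersection near a transversal point and near a point of tangency. -/

section Local

/-- The points of the first sphere that are mapped into the second one. -/
def meet (f g : S2 → E3) : Set S2 := {p | f p ∈ range g}

/-- Smoothness of a family of maps, for all times. -/
def SmoothFamily (F : ℝ → S2 → E3) : Prop :=
  ContMDiff (𝓘(ℝ, ℝ).prod (𝓡 2)) (𝓡 3) ∞ (fun x : ℝ × S2 => F x.1 x.2)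

lemma tendsto_chart_symm (p : S2) : Tendsto (chartAt E2 p).symm (𝓝 (chartAt E2 p p)) (𝓝 p) := by
  have hpe := mem_chart_source E2 p
  simpa [(chartAt E2 p).left_inv hpe] using ((chartAt E2 p).symm.continuousAt
    (x := chartAt E2 p p) ((chartAt E2 p).map_source hpe)).tendsto

lemma mem_chart_symm_image {p : S2} {V : Set E2} (hv : chartAt E2 p p ∈ V) :
    p ∈ (chartAt E2 p).symm '' V :=
  ⟨_, hv, (chartAt E2 p).left_inv (mem_chart_source E2 p)⟩

lemma isOpen_chart_symm_image {p : S2} {V : Set E2} (hV : IsOpen V)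
    (hVt : V ⊆ (chartAt E2 p).target) : IsOpen ((chartAt E2 p).symm '' V) :=
  (chartAt E2 p).symm.isOpen_image_of_subset_source hV hVt

lemma isConnected_inter_chart_image {p : S2} {V A' : Set E2} {A : Set S2}
    (hVt : V ⊆ (chartAt E2 p).target) (hA : ∀ v ∈ V, (chartAt E2 p).symm v ∈ A ↔ v ∈ A')
    (h : IsConnected (V ∩ A')) : IsConnected (A ∩ (chartAt E2 p).symm '' V) := by
  have himg : A ∩ (chartAt E2 p).symm '' V = (chartAt E2 p).symm '' (V ∩ A') := by
    ext x
    constructor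
    · rintro ⟨hx, v, hv, rfl⟩
      exact ⟨v, ⟨hv, (hA v hv).1 hx⟩, rfl⟩
    · rintro ⟨v, ⟨hv, hv'⟩, rfl⟩
      exact ⟨(hA v hv).2 hv', v, hv, rfl⟩
  rw [himg]
  exact h.image _ ((chartAt E2 p).continuousOn_symm.mono (inter_subset_left.trans hVt))

lemma SmoothFamily.contMDiff {F : ℝ → S2 → E3} (hF : SmoothFamily F) (s : ℝ) :
    ContMDiff (𝓡 2) (𝓡 3) ∞ (F s) :=
  hF.comp (contMDiff_const.prodMk contMDiff_id)

lemma SmoothFamily.continuous {F : ℝ → S2 → E3} (hF : SmoothFamily F) :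
    Continuous fun x : ℝ × S2 => F x.1 x.2 :=
  ContMDiff.continuous hF

/-- In the chart at `p`, the differential of the family restricted to the sphere directions. -/
lemma fderiv_family_inr {F : ℝ → S2 → E3} (hF : SmoothFamily F) (s : ℝ) (p : S2) (α : E2) :
    fderiv ℝ (fun z : ℝ × E2 => F z.1 ((chartAt E2 p).symm z.2)) (s, chartAt E2 p p) (0, α) =
      fderiv ℝ (fun v => F s ((chartAt E2 p).symm v)) (chartAt E2 p p) α := by
  have hd := (contDiffAt_family_comp_chart hF s p ((chartAt E2 p).map_source
    (mem_chart_source E2 p))).differentiableAt (by simp)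
  have h2 : HasFDerivAt (fun v => F s ((chartAt E2 p).symm v)) _ (chartAt E2 p p) :=
    hd.hasFDerivAt.comp (chartAt E2 p p) (hasFDerivAt_prodMk_right s (chartAt E2 p p))
  rw [h2.fderiv]
  simp

lemma fderiv_family_inl {F : ℝ → S2 → E3} (hF : SmoothFamily F) (s : ℝ) (p : S2) :
    fderiv ℝ (fun z : ℝ × E2 => F z.1 ((chartAt E2 p).symm z.2)) (s, chartAt E2 p p) (1, 0) =
      deriv (fun s => F s p) s := by
  have hpe := mem_chart_source E2 p
  have hd := (contDiffAt_family_comp_chart hF s p ((chartAt E2 p).map_source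
    hpe)).differentiableAt (by simp)
  have h1 : HasDerivAt (fun s : ℝ => (s, chartAt E2 p p)) ((1 : ℝ), (0 : E2)) s :=
    (hasDerivAt_id s).prodMk (hasDerivAt_const s _)
  have h2 := hd.hasFDerivAt.comp_hasDerivAt s h1
  simp only [Function.comp_def, (chartAt E2 p).left_inv hpe] at h2
  exact h2.deriv.symm

/-- Near a transversal intersection point the intersection stays connected. -/
lemma exists_open_isConnected_meet {F : ℝ → S2 → E3} {g : S2 → E3} (hF : SmoothFamily F)
    (hg : IsSphereEmbedding g) {s₀ : ℝ} {p₀ q₀ : S2} (hpq : F s₀ p₀ = g q₀)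
    (htr : tangentImage (F s₀) p₀ ⊔ tangentImage g q₀ = ⊤) {W : Set S2} (hW : W ∈ 𝓝 p₀) :
    ∃ V, IsOpen V ∧ p₀ ∈ V ∧ V ⊆ W ∧ ∀ᶠ s in 𝓝 s₀, IsConnected (meet (F s) g ∩ V) := by
  obtain ⟨U, h, hU, hqU, hh, hUh, hne⟩ := hg.exists_defining q₀
  set e := chartAt E2 p₀
  have hpe : p₀ ∈ e.source := mem_chart_source E2 p₀
  have hpe' : e.symm (e p₀) = p₀ := e.left_inv hpe
  have hG := contDiffAt_family_comp_chart hF s₀ p₀ (e.map_source hpe)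
  have hGU : F s₀ (e.symm (e p₀)) ∈ U := by rwa [hpe', hpq]
  have hhd : ContDiffAt ℝ ∞ h (g q₀) := hh.contDiffAt (hU.mem_nhds hqU)
  have hhd' : ContDiffAt ℝ ∞ h (F s₀ (e.symm (e p₀))) := by rwa [hpe', hpq]
  let u : ℝ × E2 → ℝ := fun z => h (F z.1 (e.symm z.2))
  have hu : ContDiffAt ℝ ∞ u (s₀, e p₀) := ContDiffAt.comp (s₀, e p₀) hhd' hG
  have hu0 : u (s₀, e p₀) = 0 := (hUh _ hGU).1 ⟨q₀, by rw [hpe', hpq]⟩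
  have hgker : tangentImage g q₀ ≤ (fderiv ℝ h (g q₀)).ker := by
    refine tangentImage_le_ker hg.contMDiff (hhd.differentiableAt (by simp)) ?_
    have : ∀ᶠ q in 𝓝 q₀, g q ∈ U :=
      hg.contMDiff.continuous.continuousAt.eventually (hU.mem_nhds hqU)
    filter_upwards [this] with q hq
    rw [(hUh _ hq).1 ⟨q, rfl⟩, (hUh _ hqU).1 ⟨q₀, rfl⟩]
  -- If every such derivative vanished, the differential of the defining function would annihilate
  -- both tangent planes, contrary to transversality.
  obtain ⟨α, hα⟩ : ∃ α, fderiv ℝ u (s₀, e p₀) (0, α) ≠ 0 := by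
    by_contra! hall
    have hfker : tangentImage (F s₀) p₀ ≤ (fderiv ℝ h (g q₀)).ker := by
      rw [tangentImage_eq (hF.contMDiff s₀)]
      rintro _ ⟨α, rfl⟩
      have h1 : HasFDerivAt u _ (s₀, e p₀) := HasFDerivAt.comp (s₀, e p₀)
        (hhd'.differentiableAt (by simp)).hasFDerivAt (hG.differentiableAt (by simp)).hasFDerivAt
      have h2 := hall α
      rw [h1.fderiv, ContinuousLinearMap.comp_apply, fderiv_family_inr hF, hpe', hpq] at h2
      exact h2
    have htop : (⊤ : Submodule ℝ E3) ≤ (fderiv ℝ h (g q₀)).ker := htr ▸ sup_le hfker hgker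
    exact hne (ContinuousLinearMap.ext fun x => htop (Submodule.mem_top (x := x)))
  have hev : ∀ᶠ z in 𝓝 s₀ ×ˢ 𝓝 (e p₀), F z.1 (e.symm z.2) ∈ U := by
    rw [← nhds_prod_eq]
    exact hG.continuousAt.eventually (hU.mem_nhds hGU)
  obtain ⟨δ, hδ, hball⟩ := exists_pos_eventually_forall_ball hev
  obtain ⟨V, hVo, hV, hVW, hVs⟩ := exists_open_isConnected_zeros (hu.of_le (by simp)) hu0 hα
    (inter_mem (inter_mem (e.open_target.mem_nhds (e.map_source hpe))
      (tendsto_chart_symm p₀ hW)) (Metric.ball_mem_nhds (e p₀) hδ))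
  have hVt : V ⊆ e.target := fun v hv => (hVW hv).1.1
  refine ⟨e.symm '' V, isOpen_chart_symm_image hVo hVt, mem_chart_symm_image hV, ?_, ?_⟩
  · rintro _ ⟨v, hv, rfl⟩
    exact (hVW hv).1.2
  · filter_upwards [hVs, hball] with s hs hsU
    rw [inter_comm] at hs
    exact isConnected_inter_chart_image hVt (fun v hv => hUh _ (hsU v (hVW hv).2)) hs

/-- The diffeomorphism `Ψ` carries the sphere `f` into the rotated parabola and the sphere `g` onto
the plane. -/
structure IsModelChart (f g : S2 → E3) (Ψ : OpenPartialHomeomorph E3 E3) : Prop where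
  smooth : ContDiffOn ℝ ∞ Ψ Ψ.source
  smooth_symm : ContDiffOn ℝ ∞ Ψ.symm Ψ.target
  parabola : ∀ p, f p ∈ Ψ.source → Ψ (f p) ∈ modelParabola
  plane : ∀ x ∈ Ψ.source, x ∈ range g ↔ Ψ x 2 = 0

/-- The signed distance, in the model, of a point of the sphere from the circle of tangency. -/
noncomputable def side (Ψ : OpenPartialHomeomorph E3 E3) (f : S2 → E3) (p : S2) : ℝ :=
  axisDist (Ψ (f p)) - 1

/-- The profile `r (r - 2) + 1` equals `(r - 1) ^ 2`; the height is thus the square of a function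
that `exists_fderiv_side_pos` shows to be a submersion. -/
lemma IsModelChart.height {f g : S2 → E3} {Ψ : OpenPartialHomeomorph E3 E3}
    (h : IsModelChart f g Ψ) {p : S2} (hp : f p ∈ Ψ.source) : Ψ (f p) 2 = side Ψ f p ^ 2 := by
  have := h.parabola p hp
  rw [modelParabola, mem_ofPred_eq] at this
  rw [this, side]
  ring

lemma side_eq_zero {f : S2 → E3} {Ψ : OpenPartialHomeomorph E3 E3} {p : S2}
    (hp : Ψ (f p) ∈ modelCircle) : side Ψ f p = 0 := by
  have := hp.1
  simp [side, axisDist, this]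

lemma contDiffAt_height {F : ℝ → S2 → E3} {g : S2 → E3} {Ψ : OpenPartialHomeomorph E3 E3}
    (hF : SmoothFamily F) {s₀ : ℝ} (hΨ : IsModelChart (F s₀) g Ψ) {p₀ : S2}
    (hp : F s₀ p₀ ∈ Ψ.source) :
    ContDiffAt ℝ ∞ (fun z : ℝ × E2 => Ψ (F z.1 ((chartAt E2 p₀).symm z.2)))
      (s₀, chartAt E2 p₀ p₀) := by
  have hpe := mem_chart_source E2 p₀
  refine ContDiffAt.comp (g := Ψ) (s₀, chartAt E2 p₀ p₀) ?_
    (contDiffAt_family_comp_chart hF s₀ p₀ ((chartAt E2 p₀).map_source hpe))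
  simp only [(chartAt E2 p₀).left_inv hpe]
  exact hΨ.smooth.contDiffAt (Ψ.open_source.mem_nhds hp)

lemma contDiffAt_side {f g : S2 → E3} {Ψ : OpenPartialHomeomorph E3 E3}
    (hf : ContMDiff (𝓡 2) (𝓡 3) ∞ f) (hΨ : IsModelChart f g Ψ) {p₀ : S2}
    (hp : f p₀ ∈ Ψ.source) (hc : Ψ (f p₀) ∈ modelCircle) :
    ContDiffAt ℝ ∞ (fun v => Ψ (f ((chartAt E2 p₀).symm v))) (chartAt E2 p₀ p₀) ∧
    ContDiffAt ℝ ∞ (fun v => side Ψ f ((chartAt E2 p₀).symm v)) (chartAt E2 p₀ p₀) := by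
  have hpe := mem_chart_source E2 p₀
  have h1 : ContDiffAt ℝ ∞ (fun v => Ψ (f ((chartAt E2 p₀).symm v))) (chartAt E2 p₀ p₀) := by
    refine ContDiffAt.comp (g := Ψ) (chartAt E2 p₀ p₀) ?_
      (contDiffAt_comp_chart hf p₀ ((chartAt E2 p₀).map_source hpe))
    simp only [(chartAt E2 p₀).left_inv hpe]
    exact hΨ.smooth.contDiffAt (Ψ.open_source.mem_nhds hp)
  refine ⟨h1, ContDiffAt.sub (ContDiffAt.sqrt ?_ ?_) contDiffAt_const⟩
  · have h2 := (contDiffAt_piLp 2).1 h1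
    exact ((h2 0).pow 2).add ((h2 1).pow 2)
  · rw [(chartAt E2 p₀).left_inv hpe, hc.1]
    exact one_ne_zero

/-- The signed distance from the circle of tangency is a submersion. -/
lemma exists_fderiv_side_pos {f g : S2 → E3} {Ψ : OpenPartialHomeomorph E3 E3}
    (hf : IsSphereEmbedding f) (hΨ : IsModelChart f g Ψ) {p₀ : S2}
    (hp : f p₀ ∈ Ψ.source) (hc : Ψ (f p₀) ∈ modelCircle) :
    ∃ α, 0 < fderiv ℝ (fun v => side Ψ f ((chartAt E2 p₀).symm v)) (chartAt E2 p₀ p₀) α := by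
  obtain ⟨hcd, hρd⟩ := contDiffAt_side hf.contMDiff hΨ hp hc
  set e := chartAt E2 p₀
  have hpe : p₀ ∈ e.source := mem_chart_source E2 p₀
  have hpe' : e.symm (e p₀) = p₀ := e.left_inv hpe
  set c : E2 → E3 := fun v => Ψ (f (e.symm v)) with hcdef
  set ρ : E2 → ℝ := fun v => side Ψ f (e.symm v) with hρdef
  have hρ := (hρd.differentiableAt (by simp)).hasFDerivAt
  have hcD := (hcd.differentiableAt (by simp)).hasFDerivAt
  have hρ0 : ρ (e p₀) = 0 := by simp only [hρdef, hpe']; exact side_eq_zero hc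
  have hcirc : c (e p₀) 0 ^ 2 + c (e p₀) 1 ^ 2 = 1 := by simp only [hcdef, hpe']; exact hc.1
  have hcoord : ∀ i, HasFDerivAt (fun v => c v i)
      ((EuclideanSpace.proj i : E3 →L[ℝ] ℝ) ∘L fderiv ℝ c (e p₀)) (e p₀) := fun i =>
    (EuclideanSpace.proj i : E3 →L[ℝ] ℝ).hasFDerivAt.comp (e p₀) hcD
  have hJinj : Function.Injective (fderiv ℝ c (e p₀)) := by
    have h1 := ((contDiffAt_comp_chart hf.contMDiff p₀ (e.map_source hpe)).differentiableAt
      (by simp)).hasFDerivAt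
    have h2 : HasFDerivAt Ψ (fderiv ℝ Ψ (f p₀)) (f (e.symm (e p₀))) := by
      rw [hpe']
      exact ((hΨ.smooth.contDiffAt (Ψ.open_source.mem_nhds hp)).differentiableAt
        (by simp)).hasFDerivAt
    have h3 : HasFDerivAt c _ (e p₀) := h2.comp (e p₀) h1
    rw [h3.fderiv]
    exact (fderiv_bijective hΨ.smooth hΨ.smooth_symm hp).1.comp (hf.injective_fderiv p₀)
  by_contra! hle
  -- If `ρ` were critical, neither the height nor the radius would change to first order, so the
  -- tangent plane would be carried into the tangent line of the circle.
  have hzero : fderiv ℝ ρ (e p₀) = 0 := by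
    ext α
    refine le_antisymm (hle α) ?_
    have := hle (-α)
    rw [map_neg] at this
    simpa using this
  have hsq : ∀ᶠ v in 𝓝 (e p₀), c v 2 = ρ v ^ 2 := by
    have : ∀ᶠ v in 𝓝 (e p₀), f (e.symm v) ∈ Ψ.source :=
      (tendsto_chart_symm p₀).eventually (hf.contMDiff.continuous.continuousAt.eventually
        (Ψ.open_source.mem_nhds hp))
    filter_upwards [this] with v hv using hΨ.height hv
  have h2 : (EuclideanSpace.proj 2 : E3 →L[ℝ] ℝ) ∘L fderiv ℝ c (e p₀) = 0 := by
    have h3 : HasFDerivAt (fun v => ρ v ^ 2) _ (e p₀) := hρ.pow 2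
    rw [(hcoord 2).unique (h3.congr_of_eventuallyEq hsq), hzero]
    simp
  have h01 : ∀ w, c (e p₀) 0 * fderiv ℝ c (e p₀) w 0 + c (e p₀) 1 * fderiv ℝ c (e p₀) w 1 = 0 := by
    intro w
    have h4 : HasFDerivAt (fun v => c v 0 ^ 2 + c v 1 ^ 2) _ (e p₀) :=
      ((hcoord 0).pow 2).add ((hcoord 1).pow 2)
    have h5 : HasFDerivAt (fun v => (ρ v + 1) ^ 2) _ (e p₀) := (hρ.add_const 1).pow 2
    have h6 : (fun v => c v 0 ^ 2 + c v 1 ^ 2) = fun v => (ρ v + 1) ^ 2 := by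
      funext v
      simp only [hρdef, hcdef, side, axisDist, sub_add_cancel]
      rw [Real.sq_sqrt (by positivity)]
    rw [h6] at h4
    have h7 := congrArg (fun T : E2 →L[ℝ] ℝ => T w) (h4.unique h5)
    simp [hzero] at h7
    linarith
  -- The angular component of the differential. A functional on a plane kills some nonzero vector,
  -- whose image then has zero radial, angular and vertical parts, against injectivity.
  let T : E2 →ₗ[ℝ] ℝ :=
    (c (e p₀) 0 • (EuclideanSpace.proj 1 : E3 →L[ℝ] ℝ).toLinearMap -
      c (e p₀) 1 • (EuclideanSpace.proj 0 : E3 →L[ℝ] ℝ).toLinearMap) ∘ₗ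
      (fderiv ℝ c (e p₀)).toLinearMap
  have hker : LinearMap.ker T ≠ ⊥ := LinearMap.ker_ne_bot_of_finrank_lt (by simp)
  obtain ⟨w, hw, hw0⟩ := (Submodule.ne_bot_iff _).1 hker
  have hT : c (e p₀) 0 * fderiv ℝ c (e p₀) w 1 - c (e p₀) 1 * fderiv ℝ c (e p₀) w 0 = 0 := hw
  have h2w : fderiv ℝ c (e p₀) w 2 = 0 := congrArg (fun T : E2 →L[ℝ] ℝ => T w) h2
  have h01w := h01 w
  refine hw0 (hJinj ?_)
  rw [map_zero]
  generalize fderiv ℝ c (e p₀) w = a at *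
  generalize c (e p₀) = b at *
  ext i
  fin_cases i
  · change a 0 = 0
    linear_combination b 0 * h01w - b 1 * hT - a 0 * hcirc
  · change a 1 = 0
    linear_combination b 1 * h01w + b 0 * hT - a 1 * hcirc
  · exact h2w

/-- At a point of the circle of tangency both tangent planes are annihilated by the differential of
the height. -/
lemma IsModelChart.tangentImage_le_ker {f g : S2 → E3} {Ψ : OpenPartialHomeomorph E3 E3}
    (hf : ContMDiff (𝓡 2) (𝓡 3) ∞ f) (hg : IsSphereEmbedding g) (hΨ : IsModelChart f g Ψ)
    {p₀ q₀ : S2} (hpq : f p₀ = g q₀) (hp : f p₀ ∈ Ψ.source) :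
    DifferentiableAt ℝ (fun x => Ψ x 2) (f p₀) ∧ fderiv ℝ (fun x => Ψ x 2) (f p₀) ≠ 0 ∧
      tangentImage f p₀ ≤ (fderiv ℝ (fun x => Ψ x 2) (f p₀)).ker ∧
      tangentImage g q₀ ≤ (fderiv ℝ (fun x => Ψ x 2) (f p₀)).ker := by
  have hhd : DifferentiableAt ℝ Ψ (f p₀) :=
    (hΨ.smooth.contDiffAt (Ψ.open_source.mem_nhds hp)).differentiableAt (by simp)
  have hh : HasFDerivAt (fun x => Ψ x 2)
      ((EuclideanSpace.proj 2 : E3 →L[ℝ] ℝ) ∘L fderiv ℝ Ψ (f p₀)) (f p₀) :=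
    (EuclideanSpace.proj 2 : E3 →L[ℝ] ℝ).hasFDerivAt.comp _ hhd.hasFDerivAt
  have h0 : Ψ (f p₀) 2 = 0 := (hΨ.plane _ hp).1 ⟨q₀, hpq.symm⟩
  refine ⟨hh.differentiableAt, fun hzero => ?_, ?_, ?_⟩
  · obtain ⟨y, hy⟩ := (fderiv_bijective hΨ.smooth hΨ.smooth_symm hp).2 (EuclideanSpace.single 2 1)
    have h3 : fderiv ℝ (fun x => Ψ x 2) (f p₀) y = 0 := by rw [hzero]; rfl
    rw [hh.fderiv, ContinuousLinearMap.comp_apply, hy] at h3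
    simp at h3
  · refine Bubbles.tangentImage_le_ker hf hh.differentiableAt ?_
    filter_upwards [hf.continuous.continuousAt.eventually (Ψ.open_source.mem_nhds hp)] with p hps
    rw [h0]
    exact (sq_nonneg _).trans_eq (hΨ.height hps).symm
  · rw [hpq]
    refine Bubbles.tangentImage_le_ker hg.contMDiff (hpq ▸ hh.differentiableAt) ?_
    have : ∀ᶠ q in 𝓝 q₀, g q ∈ Ψ.source :=
      hg.contMDiff.continuous.continuousAt.eventually (Ψ.open_source.mem_nhds (hpq ▸ hp))
    filter_upwards [this] with q hq
    rw [← hpq, h0]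
    exact ((hΨ.plane _ hq).1 ⟨q, rfl⟩).ge

/-- Both tangent planes lie in the kernel of the nonzero differential of the height. Consequently a
component of tangency contains no transversal point at all. -/
lemma IsModelChart.not_transversal {f g : S2 → E3} {Ψ : OpenPartialHomeomorph E3 E3}
    (hf : ContMDiff (𝓡 2) (𝓡 3) ∞ f) (hg : IsSphereEmbedding g) (hΨ : IsModelChart f g Ψ)
    {p₀ q₀ : S2} (hpq : f p₀ = g q₀) (hp : f p₀ ∈ Ψ.source) :
    tangentImage f p₀ ⊔ tangentImage g q₀ ≠ ⊤ := by
  obtain ⟨-, hne, hfk, hgk⟩ := hΨ.tangentImage_le_ker hf hg hpq hp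
  intro htop
  have hle : (⊤ : Submodule ℝ E3) ≤ (fderiv ℝ (fun x => Ψ x 2) (f p₀)).ker :=
    htop ▸ sup_le hfk hgk
  exact hne (ContinuousLinearMap.ext fun x => hle (Submodule.mem_top (x := x)))

/-- Along the circle of tangency, either the sphere immediately leaves the plane, or it crosses it.
-/
lemma height_sign {F : ℝ → S2 → E3} {g : S2 → E3} {Ψ : OpenPartialHomeomorph E3 E3}
    (hF : SmoothFamily F) (hg : IsSphereEmbedding g) {s₀ : ℝ} (hΨ : IsModelChart (F s₀) g Ψ)
    {p₀ q₀ : S2} (hpq : F s₀ p₀ = g q₀) (hp : F s₀ p₀ ∈ Ψ.source)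
    (hvel : Submodule.span ℝ {deriv (fun s => F s p₀) s₀} ⊔ tangentImage (F s₀) p₀ ⊔
      tangentImage g q₀ = ⊤) {l : Filter ℝ} (hl : l = 𝓝[>] s₀ ∨ l = 𝓝[<] s₀) :
    (∀ᶠ z in l ×ˢ 𝓝 p₀, 0 < Ψ (F z.1 z.2) 2) ∨
      ∀ᶠ z in l ×ˢ 𝓝 p₀, side Ψ (F s₀) z.2 = 0 → Ψ (F z.1 z.2) 2 < 0 := by
  set e := chartAt E2 p₀
  have hpe : p₀ ∈ e.source := mem_chart_source E2 p₀
  have hpe' : e.symm (e p₀) = p₀ := e.left_inv hpe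
  let h : E3 → ℝ := fun x => Ψ x 2
  obtain ⟨hh, hne', hfker, hgker⟩ := hΨ.tangentImage_le_ker (hF.contMDiff s₀) hg hpq hp
  let u : ℝ × E2 → ℝ := fun z => h (F z.1 (e.symm z.2))
  have hu : ContDiffAt ℝ ∞ u (s₀, e p₀) := (contDiffAt_piLp 2).1 (contDiffAt_height hF hΨ hp) 2
  have hsrc : ∀ᶠ p in 𝓝 p₀, F s₀ p ∈ Ψ.source :=
    (hF.contMDiff s₀).continuous.continuousAt.eventually (Ψ.open_source.mem_nhds hp)
  -- Otherwise the velocity too would lie in the kernel containing both tangent planes, and the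
  -- three could not span.
  have hne : fderiv ℝ u (s₀, e p₀) (1, 0) ≠ 0 := by
    intro hu0
    have h1 : HasFDerivAt u _ (s₀, e p₀) := HasFDerivAt.comp (s₀, e p₀)
      (g := h) (g' := fderiv ℝ h (F s₀ p₀)) (by rw [hpe']; exact hh.hasFDerivAt)
      ((contDiffAt_family_comp_chart hF s₀ p₀ (e.map_source hpe)).differentiableAt
        (by simp)).hasFDerivAt
    rw [h1.fderiv, ContinuousLinearMap.comp_apply, fderiv_family_inl hF] at hu0
    have htop : (⊤ : Submodule ℝ E3) ≤ (fderiv ℝ h (F s₀ p₀)).ker := by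
      rw [← hvel]
      refine sup_le (sup_le ?_ hfker) hgker
      rw [Submodule.span_singleton_le_iff_mem]
      exact hu0
    exact hne' (ContinuousLinearMap.ext fun x => htop (Submodule.mem_top (x := x)))
  have htend : Tendsto (fun z : ℝ × S2 => (z.1, e z.2)) (𝓝 (s₀, p₀)) (𝓝 (s₀, e p₀)) := by
    have hec : ContinuousAt e p₀ := e.continuousAt hpe
    exact ContinuousAt.prodMk continuousAt_fst
      (ContinuousAt.comp (g := e) (f := Prod.snd) (x := (s₀, p₀)) hec continuousAt_snd)
  have hsnd : Tendsto (Prod.snd : ℝ × S2 → S2) (𝓝 (s₀, p₀)) (𝓝 p₀) := continuousAt_snd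
  have hloc : ∀ᶠ z in 𝓝 (s₀, p₀), e.symm (e z.2) = z.2 ∧
      Ψ (F s₀ z.2) 2 = side Ψ (F s₀) z.2 ^ 2 :=
    ((hsnd.eventually (e.eventually_left_inverse hpe))).and
      ((hsnd.eventually hsrc).mono fun z hz => hΨ.height hz)
  have hgt : ∀ᶠ z in (𝓝[>] s₀) ×ˢ 𝓝 p₀, s₀ < z.1 :=
    tendsto_fst.eventually (self_mem_nhdsWithin : ∀ᶠ s in 𝓝[>] s₀, s₀ < s)
  have hlt : ∀ᶠ z in (𝓝[<] s₀) ×ˢ 𝓝 p₀, z.1 < s₀ :=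
    tendsto_fst.eventually (self_mem_nhdsWithin : ∀ᶠ s in 𝓝[<] s₀, s < s₀)
  have hle : ∀ t : Set ℝ, (𝓝[t] s₀) ×ˢ 𝓝 p₀ ≤ 𝓝 (s₀, p₀) := fun t => by
    rw [nhds_prod_eq]
    exact Filter.prod_mono nhdsWithin_le_nhds le_rfl
  -- At time `s₀` the height is `ρ ^ 2`. If it increases away from `s₀` on the chosen side of time,
  -- it becomes positive everywhere nearby; if it decreases, it becomes negative where `ρ = 0`.
  rcases hne.lt_or_gt with hneg | hpos
  · have hev := htend.eventually (eventually_lt_of_deriv_pos (u := fun z => -u z)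
      (hu.neg.of_le (by simp)) (by rw [fderiv_fun_neg]; simpa using hneg))
    have hev' := hev.and hloc
    rcases hl with rfl | rfl
    · right
      filter_upwards [hle _ hev', hgt] with z ⟨hz, hz1, hz2⟩ hzs hz0
      have := hz.1 hzs
      simp only [u, h, hz1] at this
      rw [hz2, hz0] at this
      linarith
    · left
      filter_upwards [hle _ hev', hlt] with z ⟨hz, hz1, hz2⟩ hzs
      have := hz.2 hzs
      simp only [u, h, hz1] at this
      rw [hz2] at this
      nlinarith [sq_nonneg (side Ψ (F s₀) z.2)]
  · have hev := htend.eventually (eventually_lt_of_deriv_pos (hu.of_le (by simp)) hpos)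
    have hev' := hev.and hloc
    rcases hl with rfl | rfl
    · left
      filter_upwards [hle _ hev', hgt] with z ⟨hz, hz1, hz2⟩ hzs
      have := hz.1 hzs
      simp only [u, h, hz1] at this
      rw [hz2] at this
      nlinarith [sq_nonneg (side Ψ (F s₀) z.2)]
    · right
      filter_upwards [hle _ hev', hlt] with z ⟨hz, hz1, hz2⟩ hzs hz0
      have := hz.2 hzs
      simp only [u, h, hz1] at this
      rw [hz2, hz0] at this
      linarith

/-- Where the sphere crosses the plane along the circle of tangency, the intersection consists of
one connected sheet on each side of the circle. -/
lemma exists_open_isConnected_meet_sides {F : ℝ → S2 → E3} {g : S2 → E3}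
    {Ψ : OpenPartialHomeomorph E3 E3} (hF : SmoothFamily F) {s₀ : ℝ}
    (hf : IsSphereEmbedding (F s₀)) (hΨ : IsModelChart (F s₀) g Ψ) {p₀ : S2}
    (hp : F s₀ p₀ ∈ Ψ.source) (hc : Ψ (F s₀ p₀) ∈ modelCircle) {l : Filter ℝ} (hl : l ≤ 𝓝 s₀)
    (hneg : ∀ᶠ z in l ×ˢ 𝓝 p₀, side Ψ (F s₀) z.2 = 0 → Ψ (F z.1 z.2) 2 < 0)
    {W : Set S2} (hW : W ∈ 𝓝 p₀) :
    ∃ V, IsOpen V ∧ p₀ ∈ V ∧ V ⊆ W ∧ ∀ᶠ s in l,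
      IsConnected (meet (F s) g ∩ {p | 0 < side Ψ (F s₀) p} ∩ V) ∧
      IsConnected (meet (F s) g ∩ {p | side Ψ (F s₀) p < 0} ∩ V) ∧
      Disjoint (meet (F s) g ∩ {p | side Ψ (F s₀) p = 0}) V := by
  obtain ⟨α, hα⟩ := exists_fderiv_side_pos hf hΨ hp hc
  have hρ := (contDiffAt_side hf.contMDiff hΨ hp hc).2
  have hu := (contDiffAt_piLp 2).1 (contDiffAt_height hF hΨ hp) 2
  set e := chartAt E2 p₀
  have hpe : p₀ ∈ e.source := mem_chart_source E2 p₀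
  have hpe' : e.symm (e p₀) = p₀ := e.left_inv hpe
  have hev : ∀ᶠ z in 𝓝 s₀ ×ˢ 𝓝 (e p₀), F z.1 (e.symm z.2) ∈ Ψ.source := by
    rw [← nhds_prod_eq]
    refine (contDiffAt_family_comp_chart hF s₀ p₀ (e.map_source hpe)).continuousAt.eventually
      (Ψ.open_source.mem_nhds ?_)
    change F s₀ (e.symm (e p₀)) ∈ Ψ.source
    rwa [hpe']
  obtain ⟨δ, hδ, hball⟩ := exists_pos_eventually_forall_ball hev
  have hneg' : ∀ᶠ z in l ×ˢ 𝓝 (e p₀), side Ψ (F s₀) (e.symm z.2) = 0 →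
      Ψ (F z.1 (e.symm z.2)) 2 < 0 :=
    (tendsto_id.prodMap (tendsto_chart_symm p₀)).eventually hneg
  obtain ⟨V, hVo, hV, hVW, hVs⟩ := exists_open_isConnected_sides (W := e.target ∩ e.symm ⁻¹' W ∩
    Metric.ball (e p₀) δ) hl (hu.of_le (WithTop.coe_le_coe.2 (le_top : (2 : ℕ∞) ≤ ⊤)))
    (hρ.of_le (WithTop.coe_le_coe.2 (le_top : (2 : ℕ∞) ≤ ⊤)))
    (by rw [hpe']; exact side_eq_zero hc)
    ((tendsto_chart_symm p₀).eventually (((hF.contMDiff s₀).continuous.continuousAt.eventually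
      (Ψ.open_source.mem_nhds hp)).mono fun p hp => hΨ.height hp)) hα hneg'
    (inter_mem (inter_mem (e.open_target.mem_nhds (e.map_source hpe))
      (tendsto_chart_symm p₀ hW)) (Metric.ball_mem_nhds (e p₀) hδ))
  have hVt : V ⊆ e.target := fun v hv => (hVW hv).1.1
  refine ⟨e.symm '' V, isOpen_chart_symm_image hVo hVt, mem_chart_symm_image hV, ?_, ?_⟩
  · rintro _ ⟨v, hv, rfl⟩
    exact (hVW hv).1.2
  · filter_upwards [hVs, hl hball] with s ⟨hs1, hs2, hs3⟩ hsU
    have hmeet : ∀ v ∈ V, e.symm v ∈ meet (F s) g ↔ Ψ (F s (e.symm v)) 2 = 0 := fun v hv =>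
      hΨ.plane _ (hsU v (hVW hv).2)
    refine ⟨isConnected_inter_chart_image hVt (fun v hv => and_congr_left' (hmeet v hv)) hs1,
      isConnected_inter_chart_image hVt (fun v hv => and_congr_left' (hmeet v hv)) hs2,
      disjoint_left.2 ?_⟩
    rintro _ ⟨h1, h2⟩ ⟨v, hv, rfl⟩
    exact (hs3 v hv h2).ne ((hmeet v hv).1 h1)

end Local

/-! ### Invariance of the parity along a family, and the reparametrisation of good families. -/

section Global

/-- The points of the first sphere at which it meets the second one transversally. -/
def transMeet (f g : S2 → E3) : Set S2 :=
  {p | ∃ q, f p = g q ∧ tangentImage f p ⊔ tangentImage g q = ⊤}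

lemma transMeet_subset (f g : S2 → E3) : transMeet f g ⊆ meet f g := by
  rintro p ⟨q, hq, -⟩
  exact ⟨q, hq.symm⟩

lemma transMeet_eq_meet {f g : S2 → E3} (h : Transversal f g) : transMeet f g = meet f g := by
  refine Subset.antisymm (transMeet_subset f g) ?_
  rintro p ⟨q, hq⟩
  exact ⟨q, hq.symm, h p q hq.symm⟩

/-- A smooth family of embedded spheres, defined for all times, whose tangencies with `g` are
isolated in time, follow the model and are passed with nonzero speed. -/
structure IsRegularFamily (g : S2 → E3) (F : ℝ → S2 → E3) : Prop where
  smooth : SmoothFamily F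
  embedding : ∀ s, IsSphereEmbedding (F s)
  link : ∀ s, IsLink (range (F s) ∩ range g)
  generic : ∀ s₀, ∀ᶠ s in 𝓝[≠] s₀, Transversal (F s) g
  model : ∀ s p q, F s p = g q → tangentImage (F s) p ⊔ tangentImage g q ≠ ⊤ →
    (∃ γ : Set E3, IsKnot γ ∧ F s p ∈ γ ∧ HasModelTangency (range (F s)) (range g) γ) ∧
    Submodule.span ℝ {deriv (fun s => F s p) s} ⊔ tangentImage (F s) p ⊔ tangentImage g q = ⊤

lemma isClosed_range_sphere {g : S2 → E3} (hg : IsSphereEmbedding g) : IsClosed (range g) :=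
  (isCompact_range hg.contMDiff.continuous).isClosed

/-- A compact set free of intersection points stays so for nearby times. -/
lemma eventually_disjoint_meet {F : ℝ → S2 → E3} {g : S2 → E3} (hF : SmoothFamily F)
    (hg : IsSphereEmbedding g) {s₀ : ℝ} {D : Set S2} (hD : IsCompact D)
    (h : Disjoint D (meet (F s₀) g)) : ∀ᶠ s in 𝓝 s₀, Disjoint D (meet (F s) g) := by
  have := hD.eventually_forall_of_forall_eventually (x₀ := s₀)
    (P := fun s p => F s p ∈ (range g)ᶜ) fun p hp =>
      hF.continuous.continuousAt.eventually ((isClosed_range_sphere hg).isOpen_compl.mem_nhds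
        (disjoint_left.1 h hp))
  filter_upwards [this] with s hs
  exact disjoint_left.2 hs

/-- If the intersection near `W` is concentrated on `C`, then for nearby times it lies in any given
neighbourhood of `C`. -/
lemma eventually_meet_inter_eq {F : ℝ → S2 → E3} {g : S2 → E3} (hF : SmoothFamily F)
    (hg : IsSphereEmbedding g) {s₀ : ℝ} {C U W : Set S2} (hU : IsOpen U) (hCU : C ⊆ U)
    (hUW : U ⊆ W) (hC : meet (F s₀) g ∩ closure W ⊆ C) :
    ∀ᶠ s in 𝓝 s₀, meet (F s) g ∩ W = meet (F s) g ∩ U := by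
  have hD : IsCompact (closure W \ U) := (isClosed_closure.sdiff hU).isCompact
  have := eventually_disjoint_meet hF hg (s₀ := s₀) hD
    (disjoint_left.2 fun p hp hpm => hp.2 (hCU (hC ⟨hpm, hp.1⟩)))
  filter_upwards [this] with s hs
  refine Subset.antisymm (fun p hp => ⟨hp.1, ?_⟩) (inter_subset_inter_right _ hUW)
  by_contra hpU
  exact disjoint_left.1 hs ⟨subset_closure hp.2, hpU⟩ hp.1

/-- Near a component of tangency every point lies on the circle of the model. -/
lemma HasModelTangency.exists_isModelChart {f g : S2 → E3} {γ : Set E3} {C : Set S2}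
    (h : HasModelTangency (range f) (range g) γ) (hγ : IsKnot γ)
    (hf : ContMDiff (𝓡 2) (𝓡 3) ∞ f) (hC : IsConnected C)
    (hCm : C ⊆ meet f g) {p₁ : S2} (hp₁ : p₁ ∈ C) (hp₁γ : f p₁ ∈ γ) :
    ∃ Ψ, IsModelChart f g Ψ ∧ ∀ p ∈ C, f p ∈ Ψ.source ∧ Ψ (f p) ∈ modelCircle := by
  obtain ⟨Ψ, hΨ, hΨ', hγs, -, hγc, hA, hB⟩ := h
  have hpar : ∀ p, f p ∈ Ψ.source → Ψ (f p) ∈ modelParabola := fun p hp =>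
    (hA ▸ mem_image_of_mem Ψ ⟨mem_range_self p, hp⟩ : Ψ (f p) ∈ modelParabola ∩ Ψ.target).1
  have hpl : ∀ x ∈ Ψ.source, x ∈ range g ↔ Ψ x 2 = 0 := by
    intro x hx
    constructor
    · intro hxg
      exact (hB ▸ mem_image_of_mem Ψ ⟨hxg, hx⟩ : Ψ x ∈ modelPlane ∩ Ψ.target).1
    · intro h0
      have : Ψ x ∈ Ψ '' (range g ∩ Ψ.source) := hB ▸ ⟨h0, Ψ.map_source hx⟩
      obtain ⟨y, ⟨hyg, hys⟩, hyx⟩ := this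
      exact Ψ.injOn hys hx hyx ▸ hyg
  have hchart : IsModelChart f g Ψ := ⟨hΨ, hΨ', hpar, hpl⟩
  have hγclosed : IsClosed γ := by
    obtain ⟨c, hc, rfl⟩ := hγ
    exact (isCompact_range hc.isEmbedding.continuous).isClosed
  have hmem : ∀ p ∈ C, f p ∈ Ψ.source → f p ∈ γ := by
    intro p hp hps
    have h0 : Ψ (f p) 2 = 0 := (hpl _ hps).1 (hCm hp)
    have hs : side Ψ f p = 0 := by
      have := hchart.height hps
      rw [h0] at this
      exact pow_eq_zero_iff two_ne_zero |>.1 this.symm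
    have hcirc : Ψ (f p) ∈ modelCircle := by
      refine ⟨?_, h0⟩
      have h1 : axisDist (Ψ (f p)) = 1 := by
        rw [side] at hs
        linarith
      rw [axisDist, Real.sqrt_eq_one] at h1
      exact h1
    rw [← hγc] at hcirc
    obtain ⟨y, hy, hyp⟩ := hcirc
    exact Ψ.injOn (hγs hy) hps hyp ▸ hy
  -- By `hmem`, on `C` lying in the chart and lying on `γ` are the same condition, one open and the
  -- other closed; a connected `C` that touches `γ` satisfies it throughout.
  have hcov : C ⊆ f ⁻¹' Ψ.source ∪ (f ⁻¹' γ)ᶜ := fun p _ => by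
    by_cases hps : f p ∈ Ψ.source
    · exact Or.inl hps
    · exact Or.inr fun hpγ => hps (hγs hpγ)
  have hdis : C ∩ (f ⁻¹' Ψ.source ∩ (f ⁻¹' γ)ᶜ) = ∅ := by
    rw [eq_empty_iff_forall_notMem]
    rintro p ⟨hp, hps, hpγ⟩
    exact hpγ (hmem p hp hps)
  have hsub : C ⊆ f ⁻¹' Ψ.source :=
    (isPreconnected_iff_subset_of_disjoint.1 hC.isPreconnected _ _
      (Ψ.open_source.preimage hf.continuous) (hγclosed.preimage hf.continuous).isOpen_compl
      hcov hdis).resolve_right fun h => h hp₁ hp₁γ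
  exact ⟨Ψ, hchart, fun p hp => ⟨hsub hp, hγc ▸ mem_image_of_mem Ψ (hmem p hp (hsub hp))⟩⟩

/-- On either side of a tangency, the intersection near it consists of an even number of pieces. -/
lemma IsRegularFamily.eventually_hasParity_tangency {g : S2 → E3} {F : ℝ → S2 → E3}
    (hF : IsRegularFamily g F) (hg : IsSphereEmbedding g) {s₀ : ℝ}
    {C W : Set S2} (hCc : IsCompact C) (hC : IsConnected C) (hW : IsOpen W) (hCW : C ⊆ W)
    (hCm : C ⊆ meet (F s₀) g) (hWC : meet (F s₀) g ∩ closure W ⊆ C)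
    {Ψ : OpenPartialHomeomorph E3 E3} (hΨ : IsModelChart (F s₀) g Ψ)
    (hΨC : ∀ p ∈ C, F s₀ p ∈ Ψ.source ∧ Ψ (F s₀ p) ∈ modelCircle)
    {l : Filter ℝ} (hl : l = 𝓝[>] s₀ ∨ l = 𝓝[<] s₀) :
    ∀ᶠ s in l, HasParity (meet (F s) g ∩ W) 0 := by
  have hl' : l ≤ 𝓝 s₀ := by
    rcases hl with rfl | rfl <;> exact nhdsWithin_le_nhds
  have hlne : l.NeBot := by
    rcases hl with rfl | rfl <;> infer_instance
  let ρ := side Ψ (F s₀)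
  -- The two alternatives of `height_sign`: lifting off (`P`) and crossing (`N`). Both are open,
  -- they cover `C`, and they exclude each other at points with `ρ = 0`, so connectedness selects
  -- one for all of `C`.
  let P : Set S2 := {p | ∀ᶠ z in l ×ˢ 𝓝 p, 0 < Ψ (F z.1 z.2) 2}
  let N : Set S2 := {p | ∀ᶠ z in l ×ˢ 𝓝 p, ρ z.2 = 0 → Ψ (F z.1 z.2) 2 < 0}
  have hopen : ∀ Q : ℝ × S2 → Prop, IsOpen {p | ∀ᶠ z in l ×ˢ 𝓝 p, Q z} := by
    intro Q
    rw [isOpen_iff_mem_nhds]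
    intro p hp
    obtain ⟨pa, ha, pb, hb, hab⟩ := eventually_prod_iff.1 hp
    filter_upwards [hb.eventually_nhds] with p' hp'
    exact eventually_prod_iff.2 ⟨pa, ha, pb, hp', hab⟩
  have hcover : C ⊆ P ∪ N := by
    intro p hp
    obtain ⟨q, hq⟩ := hCm hp
    exact height_sign hF.smooth hg hΨ hq.symm (hΨC p hp).1 (hF.model s₀ p q hq.symm
      (hΨ.not_transversal (hF.smooth.contMDiff s₀) hg hq.symm (hΨC p hp).1)).2 hl
  have hdisj : C ∩ (P ∩ N) = ∅ := by
    rw [eq_empty_iff_forall_notMem]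
    rintro p ⟨hp, hpP, hpN⟩
    have hpure : Tendsto (fun s : ℝ => (s, p)) l (l ×ˢ 𝓝 p) := tendsto_id.prodMk tendsto_const_nhds
    obtain ⟨s, hs1, hs2⟩ := ((hpure.eventually hpP).and (hpure.eventually hpN)).exists
    exact lt_asymm hs1 (hs2 (side_eq_zero (hΨC p hp).2))
  set O : Set S2 := F s₀ ⁻¹' Ψ.source
  have hO : IsOpen O := Ψ.open_source.preimage (hF.smooth.contMDiff s₀).continuous
  have hCO : C ⊆ W ∩ O := fun p hp => ⟨hCW hp, (hΨC p hp).1⟩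
  rcases isPreconnected_iff_subset_of_disjoint.1 hC.isPreconnected P N (hopen _) (hopen _)
    hcover hdisj with hCP | hCN
  -- The sphere lifts off: with the empty index type no piece is asked for, only that the
  -- intersection avoid a neighbourhood of `C`.
  · obtain ⟨U, hU, hCU, hUW, hUs⟩ := exists_open_isConnected (J := Empty) hCc hC (l := l)
      (K := fun _ _ => ∅) (B := fun s => meet (F s) g) (fun p hp W' hW' => by
        have hsrc : ∀ᶠ z in l ×ˢ 𝓝 p, F z.1 z.2 ∈ Ψ.source := by
          have : l ×ˢ 𝓝 p ≤ 𝓝 (s₀, p) := by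
            rw [nhds_prod_eq]
            exact Filter.prod_mono hl' le_rfl
          exact this (hF.smooth.continuous.continuousAt.eventually
            (Ψ.open_source.mem_nhds (hΨC p hp).1))
        obtain ⟨pa, ha, pb, hb, hab⟩ := eventually_prod_iff.1
          ((show ∀ᶠ z in l ×ˢ 𝓝 p, _ from hCP hp).and hsrc)
        obtain ⟨V, hV, hVo, hpV⟩ := mem_nhds_iff.1 (inter_mem hb hW')
        refine ⟨V, hVo, hpV, fun x hx => (hV hx).2, ?_⟩
        filter_upwards [ha] with s hs
        refine ⟨fun j => j.elim, disjoint_left.2 fun x hx hxV => ?_⟩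
        obtain ⟨h1, h2⟩ := hab hs (hV hxV).1
        exact h1.ne' ((hΨ.plane _ h2).1 hx)) hW hCW
    filter_upwards [hUs, hl' (eventually_meet_inter_eq hF.smooth hg hU hCU hUW hWC)] with s hs hsU
    rw [hsU, hs.2.inter_eq]
    exact hasParity_empty
  -- The sphere crosses: the sheets with `ρ > 0` and with `ρ < 0` are glued simultaneously, and no
  -- intersection point has `ρ = 0`.
  · obtain ⟨U, hU, hCU, hUW, hUs⟩ := exists_open_isConnected (J := Bool) hCc hC (l := l)
      (K := fun b s => meet (F s) g ∩ cond b {p | 0 < ρ p} {p | ρ p < 0})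
      (B := fun s => meet (F s) g ∩ {p | ρ p = 0}) (fun p hp W' hW' => by
        obtain ⟨V, hVo, hpV, hVW, hVs⟩ := exists_open_isConnected_meet_sides hF.smooth
          (hF.embedding s₀) hΨ (hΨC p hp).1 (hΨC p hp).2 hl' (hCN hp) hW'
        refine ⟨V, hVo, hpV, hVW, ?_⟩
        filter_upwards [hVs] with s hs
        refine ⟨fun b => ?_, hs.2.2⟩
        cases b
        · exact hs.2.1
        · exact hs.1) (hW.inter hO) hCO
    have hρc : ContinuousOn ρ O := by
      have h1 : ContinuousOn (fun p => Ψ (F s₀ p)) O :=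
        Ψ.continuousOn.comp (hF.smooth.contMDiff s₀).continuous.continuousOn fun p hp => hp
      have h2 : Continuous axisDist := by
        unfold axisDist
        fun_prop
      exact (h2.comp_continuousOn h1).sub continuousOn_const
    filter_upwards [hUs, hl' (eventually_meet_inter_eq hF.smooth hg hU hCU
      (hUW.trans inter_subset_left) hWC)] with s hs hsU
    have hUO : U ⊆ O := hUW.trans inter_subset_right
    have hset : ∀ A : Set ℝ,
        meet (F s) g ∩ U ∩ (O ∩ ρ ⁻¹' A) = meet (F s) g ∩ {p | ρ p ∈ A} ∩ U := fun A => by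
      ext p
      exact ⟨fun h => ⟨⟨h.1.1, h.2.2⟩, h.1.2⟩, fun h => ⟨⟨h.1.1, h.2⟩, hUO h.2, h.1.2⟩⟩
    rw [hsU]
    refine hasParity_zero_of_two (hρc.isOpen_inter_preimage hO (isOpen_Ioi (a := (0 : ℝ))))
      (hρc.isOpen_inter_preimage hO (isOpen_Iio (a := (0 : ℝ))))
      (disjoint_left.2 fun p h1 h2 => lt_asymm (show 0 < ρ p from h1.2) h2.2) ?_ ?_ ?_
    · intro p hp
      rcases lt_trichotomy (ρ p) 0 with h | h | h
      · exact Or.inr ⟨hUO hp.2, h⟩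
      · exact absurd hp.2 (disjoint_left.1 hs.2 ⟨hp.1, h⟩)
      · exact Or.inl ⟨hUO hp.2, h⟩
    · rw [hset]
      exact hs.1 true
    · rw [hset]
      exact hs.1 false

/-- Near a component of the intersection, the number of transversal components is locally constant
modulo two. -/
lemma IsRegularFamily.eventually_hasParity_component {g : S2 → E3} {F : ℝ → S2 → E3}
    (hF : IsRegularFamily g F) (hg : IsSphereEmbedding g) {s₀ : ℝ}
    {C W : Set S2} (hCc : IsCompact C) (hC : IsConnected C) (hW : IsOpen W) (hCW : C ⊆ W)
    (hCm : C ⊆ meet (F s₀) g) (hWC : meet (F s₀) g ∩ closure W ⊆ C) :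
    ∃ a, ∀ᶠ s in 𝓝 s₀, HasParity (transMeet (F s) g ∩ W) a := by
  have hgen : ∀ᶠ s in 𝓝[≠] s₀, transMeet (F s) g = meet (F s) g :=
    (hF.generic s₀).mono fun s hs => transMeet_eq_meet hs
  -- A single nontransversal point already puts all of `C` into the model chart, so mixed components
  -- do not occur.
  by_cases hall : C ⊆ transMeet (F s₀) g
  · obtain ⟨U, hU, hCU, hUW, hUs⟩ := exists_open_isConnected (J := Unit) hCc hC (l := 𝓝 s₀)
      (K := fun _ s => meet (F s) g) (B := fun _ => ∅) (fun p hp W' hW' => by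
        obtain ⟨q, hq, htr⟩ := hall hp
        obtain ⟨V, hVo, hpV, hVW, hVs⟩ := exists_open_isConnected_meet hF.smooth hg hq htr hW'
        exact ⟨V, hVo, hpV, hVW, hVs.mono fun s hs => ⟨fun _ => hs, empty_disjoint _⟩⟩) hW hCW
    refine ⟨1, ?_⟩
    have heq : ∀ᶠ s in 𝓝 s₀, transMeet (F s) g ∩ W = meet (F s) g ∩ W := by
      filter_upwards [eventually_nhdsWithin_iff.1 hgen] with s hs
      by_cases hss : s = s₀
      · subst hss
        exact Subset.antisymm (inter_subset_inter_left _ (transMeet_subset _ _)) fun p hp =>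
          ⟨hall (hWC ⟨hp.1, subset_closure hp.2⟩), hp.2⟩
      · rw [hs hss]
    filter_upwards [heq, hUs, eventually_meet_inter_eq hF.smooth hg hU hCU hUW hWC] with s h1 h2 h3
    rw [h1, h3]
    exact hasParity_one_of_isConnected (h2.1 ())
  · obtain ⟨p₁, hp₁, hp₁t⟩ := not_subset.1 hall
    obtain ⟨q₁, hq₁⟩ := hCm hp₁
    obtain ⟨⟨γ, hγ, hpγ, hmodel⟩, -⟩ := hF.model s₀ p₁ q₁ hq₁.symm
      fun htop => hp₁t ⟨q₁, hq₁.symm, htop⟩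
    obtain ⟨Ψ, hΨ, hΨC⟩ := hmodel.exists_isModelChart hγ (hF.smooth.contMDiff s₀) hC hCm hp₁ hpγ
    have hside : ∀ᶠ s in 𝓝[≠] s₀, HasParity (meet (F s) g ∩ W) 0 := by
      rw [← nhdsLT_sup_nhdsGT]
      exact eventually_sup.2
        ⟨hF.eventually_hasParity_tangency hg hCc hC hW hCW hCm hWC hΨ hΨC (Or.inr rfl),
          hF.eventually_hasParity_tangency hg hCc hC hW hCW hCm hWC hΨ hΨC (Or.inl rfl)⟩
    refine ⟨0, ?_⟩
    filter_upwards [eventually_nhdsWithin_iff.1 (hside.and hgen)] with s hs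
    by_cases hss : s = s₀
    · subst hss
      -- At the critical time itself the count is zero too, since every intersection point in `W` is
      -- a tangency.
      have hempty : transMeet (F s) g ∩ W = ∅ := by
        rw [eq_empty_iff_forall_notMem]
        rintro p ⟨⟨q, hq, htop⟩, hpW⟩
        have hpC := hWC ⟨⟨q, hq.symm⟩, subset_closure hpW⟩
        exact hΨ.not_transversal (hF.smooth.contMDiff s) hg hq (hΨC p hpC).1 htop
      rw [hempty]
      exact hasParity_empty
    · rw [(hs hss).2]
      exact (hs hss).1

/-- Finitely many disjoint closed sets have neighbourhoods with disjoint closures. -/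
lemma exists_separating_nhds {X : Type*} [TopologicalSpace X] [NormalSpace X] {n : ℕ}
    {C : Fin n → Set X} (hC : ∀ i, IsClosed (C i)) (hd : ∀ i j, i ≠ j → Disjoint (C i) (C j)) :
    ∃ W : Fin n → Set X, (∀ i, IsOpen (W i)) ∧ (∀ i, C i ⊆ W i) ∧
      ∀ i j, i ≠ j → Disjoint (closure (W i)) (closure (W j)) := by
  have hsep : ∀ i j, ∃ A B : Set X, IsOpen A ∧ IsOpen B ∧ C i ⊆ A ∧ C j ⊆ B ∧
      (i ≠ j → Disjoint A B) := by
    intro i j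
    by_cases hij : i = j
    · exact ⟨univ, univ, isOpen_univ, isOpen_univ, subset_univ _, subset_univ _,
        fun h => absurd hij h⟩
    · obtain ⟨A, B, hA, hB, hCA, hCB, hAB⟩ := normal_separation (hC i) (hC j) (hd i j hij)
      exact ⟨A, B, hA, hB, hCA, hCB, fun _ => hAB⟩
  choose A B hA hB hCA hCB hAB using hsep
  have hW : ∀ i, ∃ W, IsOpen W ∧ C i ⊆ W ∧ closure W ⊆ ⋂ j, A i j ∩ B j i := fun i =>
    normal_exists_closure_subset (hC i)
      (isOpen_iInter_of_finite fun j => (hA i j).inter (hB j i))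
      (subset_iInter fun j => subset_inter (hCA i j) (hCB j i))
  choose W hWo hCW hWc using hW
  refine ⟨W, hWo, hCW, fun i j hij => (hAB i j hij).mono ?_ ?_⟩
  · exact (hWc i).trans ((iInter_subset _ j).trans inter_subset_left)
  · exact (hWc j).trans ((iInter_subset _ i).trans inter_subset_right)

lemma isConnected_preimage_knot {f : S2 → E3} (hf : IsSphereEmbedding f) {c : Circle → E3}
    (hc : IsCircleEmbedding c) (hcf : range c ⊆ range f) : IsConnected (f ⁻¹' range c) := by
  have himg : f '' (f ⁻¹' range c) = range c := image_preimage_eq_of_subset hcf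
  have hconn : IsConnected (range c) := isConnected_range hc.isEmbedding.continuous
  refine ⟨?_, hf.isEmbedding.isInducing.isPreconnected_image.1
    (by rw [himg]; exact hconn.isPreconnected)⟩
  rw [← image_nonempty (f := f), himg]
  exact hconn.nonempty

/-- The number of transversal components is locally constant modulo two. -/
lemma IsRegularFamily.eventually_hasParity {g : S2 → E3} {F : ℝ → S2 → E3}
    (hF : IsRegularFamily g F) (hg : IsSphereEmbedding g) (s₀ : ℝ) :
    ∃ a, ∀ᶠ s in 𝓝 s₀, HasParity (transMeet (F s) g) a := by
  obtain ⟨n, c, hc, hdis, hL⟩ := hF.link s₀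
  have hcont := (hF.smooth.contMDiff s₀).continuous
  have hcf : ∀ i, range (c i) ⊆ range (F s₀) ∩ range g := fun i =>
    hL ▸ subset_iUnion (fun i => range (c i)) i
  have hclosed : ∀ i, IsClosed (F s₀ ⁻¹' range (c i)) := fun i =>
    (isCompact_range (hc i).isEmbedding.continuous).isClosed.preimage hcont
  obtain ⟨W, hWo, hCW, hWd⟩ := exists_separating_nhds hclosed
    fun i j hij => (hdis i j hij).preimage _
  have hcover : ∀ p ∈ meet (F s₀) g, ∃ i, p ∈ F s₀ ⁻¹' range (c i) := fun p hp => by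
    have : F s₀ p ∈ ⋃ i, range (c i) := hL ▸ ⟨mem_range_self p, hp⟩
    obtain ⟨i, hi⟩ := mem_iUnion.1 this
    exact ⟨i, hi⟩
  have hlocal : ∀ i, ∃ a, ∀ᶠ s in 𝓝 s₀, HasParity (transMeet (F s) g ∩ W i) a := fun i => by
    refine hF.eventually_hasParity_component hg (hclosed i).isCompact
      (isConnected_preimage_knot (hF.embedding s₀) (hc i) ((hcf i).trans inter_subset_left))
      (hWo i) (hCW i) (fun p hp => (hcf i hp).2) ?_
    rintro p ⟨hpm, hpW⟩
    obtain ⟨j, hj⟩ := hcover p hpm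
    by_cases hij : i = j
    · exact hij ▸ hj
    · exact absurd (subset_closure (hCW j hj)) (disjoint_left.1 (hWd i j hij) hpW)
  choose a ha using hlocal
  refine ⟨∑ i, a i, ?_⟩
  -- The complement of the separating neighbourhoods is compact, so no new component can appear
  -- there at nearby times.
  have hout := eventually_disjoint_meet hF.smooth hg (s₀ := s₀)
    (isOpen_iUnion hWo).isClosed_compl.isCompact (disjoint_left.2 fun p hp hpm => by
      obtain ⟨i, hi⟩ := hcover p hpm
      exact hp (mem_iUnion.2 ⟨i, hCW i hi⟩))
  filter_upwards [eventually_all.2 ha, hout] with s hs hso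
  refine HasParity.iUnion hWo (fun p hp => ?_)
    (fun i j hij => (hWd i j hij).mono subset_closure subset_closure) hs
  by_contra hpW
  exact disjoint_left.1 hso hpW (transMeet_subset _ _ hp)

/-- A regular family does not separate two spheres that meet transversally in one circle. -/
lemma IsRegularFamily.not_disjoint {g : S2 → E3} {F : ℝ → S2 → E3}
    (hF : IsRegularFamily g F) (hg : IsSphereEmbedding g) {s₀ s₁ : ℝ}
    (htr : Transversal (F s₀) g) (hknot : IsKnot (range (F s₀) ∩ range g)) :
    ¬ Disjoint (range (F s₁)) (range g) := by
  intro hdisj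
  choose a ha using hF.eventually_hasParity hg
  have hconst : IsLocallyConstant a := (IsLocallyConstant.iff_eventually_eq a).2 fun s => by
    filter_upwards [ha s] with s' hs'
    exact (ha s').self_of_nhds.unique hs'
  have h0 : HasParity (transMeet (F s₀) g) 1 := by
    obtain ⟨c, hc, hL⟩ := hknot
    have hset : transMeet (F s₀) g = F s₀ ⁻¹' range c := by
      rw [transMeet_eq_meet htr, ← hL, preimage_inter, preimage_range, univ_inter]
      rfl
    rw [hset]
    exact hasParity_one_of_isConnected
      (isConnected_preimage_knot (hF.embedding s₀) hc (hL ▸ inter_subset_left))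
  have h1 : HasParity (transMeet (F s₁) g) 0 := by
    have hset : transMeet (F s₁) g = ∅ := by
      rw [eq_empty_iff_forall_notMem]
      intro p hp
      exact disjoint_left.1 hdisj (mem_range_self p) (transMeet_subset _ _ hp)
    rw [hset]
    exact hasParity_empty
  have h01 := hconst.apply_eq_of_preconnectedSpace s₀ s₁
  rw [(ha s₀).self_of_nhds.unique h0, (ha s₁).self_of_nhds.unique h1] at h01
  exact one_ne_zero h01

lemma sin_sq_mem_Icc (s : ℝ) : Real.sin s ^ 2 ∈ Icc (0 : ℝ) 1 := ⟨sq_nonneg _, Real.sin_sq_le_one s⟩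

lemma hasDerivAt_sin_sq (s : ℝ) :
    HasDerivAt (fun s => Real.sin s ^ 2) (2 * Real.sin s * Real.cos s) s := by
  have h : HasDerivAt (fun s => Real.sin s ^ 2) _ s := (Real.hasDerivAt_sin s).pow 2
  convert h using 1
  simp

/-- Slowing a good family down at its end points makes it a regular family. -/
lemma IsGoodFamily.isRegularFamily {g : S2 → E3} {Φ : ℝ → S2 → E3} (hΦ : IsGoodFamily g Φ)
    (h0 : Transversal (Φ 0) g) (h1 : Transversal (Φ 1) g) :
    IsRegularFamily g fun s => Φ (Real.sin s ^ 2) := by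
  -- The derivative of `sin²` vanishes exactly where its value is `0` or `1`, and these times are
  -- transversal by `h0` and `h1`. At a critical time the reparametrisation therefore has nonzero
  -- speed.
  have hcrit : ∀ s, ¬ Transversal (Φ (Real.sin s ^ 2)) g →
      2 * Real.sin s * Real.cos s ≠ 0 ∧ Real.sin s ^ 2 ∈ Ioo (0 : ℝ) 1 := by
    intro s hs
    have hsin : Real.sin s ≠ 0 := fun h => hs (by simpa [h] using h0)
    have hcos : Real.cos s ≠ 0 := fun h => hs (by
      have : Real.sin s ^ 2 = 1 := by rw [Real.sin_sq, h]; norm_num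
      rwa [this])
    refine ⟨by positivity, by positivity, ?_⟩
    rw [Real.sin_sq]
    have : 0 < Real.cos s ^ 2 := by positivity
    linarith
  refine ⟨?_, fun s => hΦ.embedding _ (sin_sq_mem_Icc s), fun s => hΦ.link _ (sin_sq_mem_Icc s),
    fun s₀ => ?_, fun s p q hpq hne => ⟨hΦ.model _ (sin_sq_mem_Icc s) p q hpq hne, ?_⟩⟩
  · have hsin : ContMDiff 𝓘(ℝ, ℝ) 𝓘(ℝ, ℝ) ∞ fun s : ℝ => Real.sin s ^ 2 :=
      (Real.contDiff_sin.pow 2).contMDiff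
    have hmap : ContMDiff (𝓘(ℝ, ℝ).prod (𝓡 2)) (𝓘(ℝ, ℝ).prod (𝓡 2)) ∞
        (fun x : ℝ × S2 => (Real.sin x.1 ^ 2, x.2)) :=
      (hsin.comp contMDiff_fst).prodMk contMDiff_snd
    exact hΦ.smooth.comp_contMDiff hmap fun x => ⟨sin_sq_mem_Icc x.1, mem_univ _⟩
  · have hev : ∀ᶠ s in 𝓝[≠] s₀, ∀ t ∈ {t ∈ Icc (0 : ℝ) 1 | ¬ Transversal (Φ t) g},
        Real.sin s ^ 2 ≠ t := by
      -- A critical value is either not attained at `s₀`, and is avoided by continuity, or is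
      -- attained with nonzero speed and left at once.
      refine (eventually_all_finite hΦ.finite_critical).2 fun t ht => ?_
      by_cases hts : Real.sin s₀ ^ 2 = t
      · exact (hasDerivAt_sin_sq s₀).eventually_ne (hcrit s₀ (hts ▸ ht.2)).1
      · exact nhdsWithin_le_nhds ((hasDerivAt_sin_sq s₀).continuousAt.eventually_ne hts)
    filter_upwards [hev] with s hs
    by_contra hns
    exact hs _ ⟨sin_sq_mem_Icc s, hns⟩ rfl
  · obtain ⟨hd, hmem⟩ := hcrit s fun h => hne (h p q hpq)
    have hnhds : Icc (0 : ℝ) 1 ∈ 𝓝 (Real.sin s ^ 2) := Icc_mem_nhds hmem.1 hmem.2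
    have hdiff : DifferentiableAt ℝ (fun t => Φ t p) (Real.sin s ^ 2) := by
      have hmap : ContMDiff 𝓘(ℝ, ℝ) (𝓘(ℝ, ℝ).prod (𝓡 2)) ∞ (fun t : ℝ => (t, p)) :=
        contMDiff_id.prodMk contMDiff_const
      have hc : ContMDiffOn 𝓘(ℝ, ℝ) (𝓡 3) ∞ (fun t => Φ t p) (Icc 0 1) :=
        hΦ.smooth.comp hmap.contMDiffOn fun t ht => ⟨ht, mem_univ _⟩
      exact ((contMDiffOn_iff_contDiffOn.1 hc).contDiffAt hnhds).differentiableAt (by simp)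
    -- By the chain rule the new velocity is a nonzero multiple of the old one, so the span is
    -- unchanged; the time is interior, so the one-sided derivative is the ordinary one.
    have hvel : deriv (fun s => Φ (Real.sin s ^ 2) p) s =
        (2 * Real.sin s * Real.cos s) • velocity Φ (Real.sin s ^ 2) p := by
      rw [velocity, derivWithin_of_mem_nhds hnhds]
      exact (HasDerivAt.scomp s hdiff.hasDerivAt (hasDerivAt_sin_sq s)).deriv
    rw [hvel, Submodule.span_singleton_smul_eq (isUnit_iff_ne_zero.2 hd)]
    exact hΦ.transversal _ (sin_sq_mem_Icc s) p q hpq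

end Global

end Bubbles

theorem theoremT (f g : Bubbles.S2 → Bubbles.E3)
    (hf : Bubbles.IsSphereEmbedding f) (hg : Bubbles.IsSphereEmbedding g)
    (htrans : Bubbles.Transversal f g)
    (hcircle : Bubbles.IsKnot (Set.range f ∩ Set.range g)) :
    ¬ ∃ Φ : ℝ → Bubbles.S2 → Bubbles.E3,
        Bubbles.IsGoodFamily g Φ ∧ Φ 0 = f ∧ Disjoint (Set.range (Φ 1)) (Set.range g) := by
  rintro ⟨Φ, hΦ, rfl, hdisj⟩
  have h1 : Bubbles.Transversal (Φ 1) g := fun p q hpq =>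
    absurd ⟨q, hpq.symm⟩ (Set.disjoint_left.1 hdisj (Set.mem_range_self p))
  have hreg := hΦ.isRegularFamily htrans h1
  -- The parameters `0` and `π / 2` are chosen because `sin²` takes the values `0` and `1` there.
  refine hreg.not_disjoint hg (s₀ := 0) (s₁ := Real.pi / 2) ?_ ?_ ?_
  · simpa using htrans
  · simpa using hcircle
  · simpa using hdisj
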